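/- Let $q$ be a prime power, let $H=\mathrm{PG}(2,q)$ be embedded as a plane in $\mathrm{PG}(3,q)$, and let $\mathcal{K}$ be a $q$-arc in $H$, i.e. a set of $q$ points of $H$ such that any three distinct points of $\mathcal{K}$ span $H$. A tangent line to $\mathcal{K}$ is a line of $H$ containing exactly one point of $\mathcal{K}$, and an affine point is a point of $\mathrm{PG}(3,q)$ not in $H$. Let $(\mathcal{P},\mathcal{L},\mathcal{I})$ be the following incidence structure. - $\mathcal{P}$: the lines of $\mathrm{PG}(3,q)$, not in $H$, through a point of $\mathcal{K}$. - $\mathcal{L}$: (1) the affine points of $\mathrm{PG}(3,q)$; (2) the planes of $\mathrm{PG}(3,q)$, different from $H$, through a tangent line to $\mathcal{K}$. - $\mathcal{I}$: natural incidence, i.e. $\ell\in\mathcal{P}$ is incident with an affine point if it contains that point, and with a plane if it is contained in that plane. Then $(\mathcal{P},\mathcal{L},\mathcal{I})$ is a generalised quadrangle of order $(q-1,q+1)$: every element of $\mathcal{L}$ is incident with exactly $q$ elements of $\mathcal{P}$, every element of $\mathcal{P}$ is incident with exactly $q+2$ elements of $\mathcal{L}$, two distinct elements of $\mathcal{P}$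 are incident with at most one common element of $\mathcal{L}$ and vice versa, and whenever $x\in\mathcal{P}$ and $L\in\mathcal{L}$ are not incident there is a unique pair $(y,M)\in\mathcal{P}\times\mathcal{L}$ with $x\,\mathcal{I}\,M\,\mathcal{I}\,y\,\mathcal{I}\,L$. Moreover, if $q$ is odd, then $(\mathcal{P},\mathcal{L},\mathcal{I})$ is isomorphic to the Ahrens–Szekeres generalised quadrangle $\mathrm{AS}(q)$, whose points are the points $(x,y,z)$ of the affine space $\mathrm{AG}(3,q)$, whose lines are the curves 1. $\{(\sigma,a,b):\sigma\in\mathbb{F}_q\}$, 2. $\{(a,\sigma,b):\sigma\in\mathbb{F}_q\}$, 3. $\{(c\sigma^2-b\sigma+a,\,-2c\sigma+b,\,\sigma):\sigma\in\mathbb{F}_q\}$ for $a,b,c\in\mathbb{F}_q$, and whose incidence is containment. -/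

import Mathlib

open scoped LinearAlgebra.Projectivization

universe u v

namespace ArcGQ

/-- The incidence relation `I` between a set `P` of points and a set `L` of lines is a
generalised quadrangle of order `(s, t)`. -/
structure IsGQ {P : Type*} {L : Type*} (I : P → L → Prop) (s t : ℕ) : Prop where
  nonempty_points : Nonempty P
  nonempty_lines : Nonempty L
  one_le_s : 1 ≤ s
  one_le_t : 1 ≤ t
  /-- Each line is incident with exactly `s + 1` points. -/
  points_on_line : ∀ l : L, {p : P | I p l}.ncard = s + 1
  /-- Each point is incident with exactly `t + 1` lines. -/
  lines_through_point : ∀ p : P, {l : L | I p l}.ncard = t + 1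
  /-- Two distinct points are incident with at most one common line. -/
  line_unique : ∀ p p' : P, p ≠ p' → ∀ l l' : L, I p l → I p' l → I p l' → I p' l' → l = l'
  /-- Two distinct lines are incident with at most one common point. -/
  point_unique : ∀ l l' : L, l ≠ l' → ∀ p p' : P, I p l → I p l' → I p' l → I p' l' → p = p'
  /-- If `p` is not on `l`, there is a unique pair `(p', l')` with `p I l' I p' I l`. -/
  unique_pair : ∀ (p : P) (l : L), ¬ I p l → ∃! x : P × L, I p x.2 ∧ I x.1 x.2 ∧ I x.1 l

/-- Isomorphism of incidence structures: bijections on points and on lines that preserve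
incidence and non-incidence. -/
def Isomorphic {P L P' L' : Type*} (I : P → L → Prop) (I' : P' → L' → Prop) : Prop :=
  ∃ (e : P ≃ P') (f : L ≃ L'), ∀ p l, I p l ↔ I' (e p) (f l)

section Construction

variable {F : Type u} [Field F] {V : Type v} [AddCommGroup V] [Module F V]

/-- `K` is an arc of the projective plane `H`: a set of points of `H`, any three of which span
`H`. Here `H` is a linear subspace of `V` (of dimension 3 in use), and `ℙ F V` is the set of
points of the ambient projective space. -/
def IsArc (H : Submodule F V) (K : Set (ℙ F V)) : Prop :=
  (∀ P ∈ K, P.submodule ≤ H) ∧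
    ∀ P ∈ K, ∀ Q ∈ K, ∀ R ∈ K, P ≠ Q → P ≠ R → Q ≠ R →
      P.submodule ⊔ Q.submodule ⊔ R.submodule = H

/-- `T` is a tangent line to `K` in the plane `H`: a projective line of `H` that contains exactly
one point of `K`. -/
def IsTangent (H : Submodule F V) (K : Set (ℙ F V)) (T : Submodule F V) : Prop :=
  Module.finrank F T = 2 ∧ T ≤ H ∧ ∃! P : ℙ F V, P ∈ K ∧ P.submodule ≤ T

/-- The points of the incidence structure: the projective lines not in `H` through a
point of `K`. -/
def QPoint (H : Submodule F V) (K : Set (ℙ F V)) : Type v :=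
  {l : Submodule F V // Module.finrank F l = 2 ∧ ¬ l ≤ H ∧ ∃ P ∈ K, P.submodule ≤ l}

/-- The affine points: the projective points not in `H`. -/
def AffinePoint (H : Submodule F V) : Type v :=
  {A : ℙ F V // ¬ A.submodule ≤ H}

/-- The projective planes, different from `H`, through a tangent line to `K`. -/
def TangentPlane (H : Submodule F V) (K : Set (ℙ F V)) : Type v :=
  {E : Submodule F V // Module.finrank F E = 3 ∧ E ≠ H ∧ ∃ T, IsTangent H K T ∧ T ≤ E}

/-- The lines of the incidence structure. -/
abbrev QLine (H : Submodule F V) (K : Set (ℙ F V)) : Type v :=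
  AffinePoint H ⊕ TangentPlane H K

/-- Natural incidence: a projective line is incident with the affine points on it and with the
planes that contain it. -/
def QInc (H : Submodule F V) (K : Set (ℙ F V)) : QPoint H K → QLine H K → Prop
  | l, Sum.inl A => A.1.submodule ≤ l.1
  | l, Sum.inr E => l.1 ≤ E.1

end Construction

section AhrensSzekeres

variable (F : Type u) [Field F]

/-- The lines of the Ahrens-Szekeres quadrangle: three families of curves in the affine space
`AG(3, F)`, each curve being parametrised by `σ` ranging over `F`. -/
def asCurves : Set (Set (F × F × F)) :=
  {S | (∃ a b : F, S = Set.range fun σ : F => (σ, a, b)) ∨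
    (∃ a b : F, S = Set.range fun σ : F => (a, σ, b)) ∨
    ∃ a b c : F, S = Set.range fun σ : F => (c * σ ^ 2 - b * σ + a, -2 * c * σ + b, σ)}

/-- The Ahrens-Szekeres quadrangle (meaningful for finite `F` of odd order): the points are those
of `AG(3, F)`, the lines are the curves above, and incidence is membership. -/
def ASInc : F × F × F → asCurves F → Prop := fun x S => x ∈ S.1

end AhrensSzekeres

end ArcGQ

/-!
Let `H` be the plane `δ = 0`. Every subspace outside `H` is a cone `S ⊔ ⟨u⟩` over its part `S` at
infinity, with `δ u = 1` and `u` determined modulo `S` (`exists_eq_cone`, `cone_le_cone`). The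
elements of the incidence structure are thus pairs of a direction (a point of `K`, a tangent, or
`⊥`) and a translation class, and incidence becomes membership of a difference of vectors in a
subspace of `H`.

*The quadrangle.* The only facts about the arc that are needed are that each of its points lies on
exactly two tangents (`exists_two_tangents`, by counting slopes) and that a line of `H` through a
point of `K` is a tangent or contains exactly one further point. With them the incidence axioms are
checked case by case (`isGQ`).

*The isomorphism.* For `q` odd, `K` is a conic minus one point (`exists_standard_form`). To see
this, let `f i` be the product of the two tangent forms at the `i`-th point. Segre's lemma of
tangents makes `f i (p j)` antisymmetric after scaling (`exists_antisymm_tangent_forms`). If `K`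
were on no conic, its image under the Veronese map would span, so `f` would extend to an
alternating form on the space of quadratic monomials. Since `f i` has a double point at `p i`, it
is invariant under translation by `p i`, and this becomes a cubic equation for the points of the
arc (`exists_cubic`): with base points on the arc it reads `x f(y, z) = y z (β y + γ z)`, where
`f` is the product of the tangents at `(1 : 0 : 0)`. Every line through `(1 : 0 : 0)` other than the
two tangents is a secant, so the equation describes `x / z` as a function of `y / z` on the
complement of three points, and this function is injective because no three points of the arc are
collinear. For `q > 5` an involution of the projective line forces `β y + γ z` to be one of the
tangents (`eq_root_of_injOn`), the cubic splits, and `K` lies on a conic after all. For `q ≤ 5`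
dimension counting suffices.

In coordinates with `K = {(s² : 2s : 1)}` the two tangents at the point with parameter `s` are
`X₁ = 2 s X₂` (through the missing point of the conic) and `X₀ - s X₁ + s² X₂ = 0` (the tangent of
the conic). The values `y` and `x` of these two forms describe the affine lines through the point,
and `(x, y, s)` are the coordinates in which the structure is the Ahrens-Szekeres quadrangle.
-/

namespace ArcGQ

/-! ### Tangent forms of a `q`-arc -/

/-- The vectors `p i` represent distinct points of a projective plane, no three of them
collinear. -/
structure ArcFamily {F W ι : Type*} [Field F] [AddCommGroup W] [Module F W] (p : ι → W) :
    Prop where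
  pair : ∀ i j, i ≠ j → LinearIndependent F ![p i, p j]
  triple : ∀ i j k, i ≠ j → i ≠ k → j ≠ k → ∀ c : Module.Dual F W,
    c (p i) = 0 → c (p j) = 0 → c (p k) = 0 → c = 0

/-- The two tangents at a point `p i` of a `q`-arc, as linear forms `a` and `b`. Besides vanishing
at `p i` only, they have the property that the remaining points of the arc realise every nonzero
value of the ratio `b / a`: each line through `p i` other than the two tangents is a secant. -/
theorem exists_tangent_forms {F W ι : Type*} [Field F] [Finite F] [AddCommGroup W] [Module F W]
    (hW : Module.finrank F W = 3) {p : ι → W} (hp : ArcFamily (F := F) p)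
    (hι : Nat.card ι = Nat.card F) (i : ι) :
    ∃ a b : Module.Dual F W, a (p i) = 0 ∧ b (p i) = 0 ∧
      (∀ j, j ≠ i → a (p j) ≠ 0 ∧ b (p j) ≠ 0) ∧
      (∀ x, a x = 0 → b x = 0 → x ∈ Submodule.span F {p i}) ∧
      ∀ c : F, c ≠ 0 → ∃ j, j ≠ i ∧ b (p j) = c * a (p j) := by
  classical
  have hF : 1 < Nat.card F := Finite.one_lt_card
  have : Finite ι := Nat.finite_of_card_ne_zero (by omega)
  have := Fintype.ofFinite ι
  have := Fintype.ofFinite F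
  have : Nontrivial ι := Finite.one_lt_card_iff_nontrivial.1 (hι ▸ hF)
  obtain ⟨k, hk⟩ := exists_ne i
  have hli := hp.pair i k hk.symm
  obtain ⟨r, hr⟩ : ∃ r, r ∉ Submodule.span F (Set.range ![p i, p k]) := by
    by_contra! h
    have h1 := finrank_span_eq_card hli
    rw [(Submodule.eq_top_iff'.2 h), finrank_top, hW] at h1
    simp at h1
  have hli3 : LinearIndependent F ![r, p i, p k] :=
    linearIndependent_finCons.2 ⟨hli, hr⟩
  let B := basisOfLinearIndependentOfCardEqFinrank hli3 (by simp [hW])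
  have hB : ⇑B = ![r, p i, p k] := coe_basisOfLinearIndependentOfCardEqFinrank _ _
  have hB1 : p i = B 1 := by simp [hB]
  have hB2 : p k = B 2 := by simp [hB]
  let m := B.coord 2
  let n := B.coord 0
  have hmi : m (p i) = 0 := by simp [m, hB1]
  have hni : n (p i) = 0 := by simp [n, hB1]
  have hmk : m (p k) = 1 := by simp [m, hB2]
  have hnk : n (p k) = 0 := by simp [n, hB2]
  have hn0 : n ≠ 0 := fun h => by simpa [n] using LinearMap.congr_fun h (B 0)
  have hker : ∀ x, m x = 0 → n x = 0 → x ∈ Submodule.span F {p i} := by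
    intro x h1 h2
    have := B.sum_repr x
    rw [Fin.sum_univ_three] at this
    rw [← this, hB1]
    simp only [m, n, Module.Basis.coord_apply] at h1 h2
    rw [h1, h2]
    simpa using Submodule.smul_mem _ _ (Submodule.mem_span_singleton_self _)
  have hnj : ∀ j, j ≠ i → j ≠ k → n (p j) ≠ 0 := fun j h1 h2 h =>
    hn0 (hp.triple i k j hk.symm h1.symm h2.symm n hni hnk h)
  have hcomb : ∀ j, j ≠ i → ∀ l, l ≠ i → j ≠ l → ∀ t : F, m (p j) = t * n (p j) →
      m (p l) = t * n (p l) → False := by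
    intro j hj l hl hjl t h1 h2
    have := hp.triple i j l hj.symm hl.symm hjl (m - t • n) (by simp [hmi, hni])
      (by simp [h1]) (by simp [h2])
    have := LinearMap.congr_fun this (p k)
    simp [hmk, hnk] at this
  let S : Finset ι := Finset.univ \ {i, k}
  let ρ : ι → F := fun j => m (p j) / n (p j)
  have hS : ∀ j, j ∈ S ↔ j ≠ i ∧ j ≠ k := by intro j; simp [S]
  have hρinj : Set.InjOn ρ S := by
    intro j hj l hl h
    have hj := (hS j).1 hj
    have hl := (hS l).1 hl
    by_contra hjl
    refine hcomb j hj.1 l hl.1 hjl (ρ j) ?_ ?_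
    · exact (div_mul_cancel₀ _ (hnj j hj.1 hj.2)).symm
    · rw [h]; exact (div_mul_cancel₀ _ (hnj l hl.1 hl.2)).symm
  have hcard : (Finset.univ \ S.image ρ).card = 2 := by
    have h1 : S.card = Fintype.card ι - 2 := by
      rw [Finset.card_sdiff_of_subset (Finset.subset_univ _), Finset.card_pair hk.symm,
        Finset.card_univ]
    rw [Finset.card_sdiff_of_subset (Finset.subset_univ _), Finset.card_image_of_injOn hρinj, h1,
      Finset.card_univ]
    simp only [Nat.card_eq_fintype_card] at hι hF
    omega
  obtain ⟨s, t, hst, hst2⟩ := Finset.card_eq_two.1 hcard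
  have hmiss : ∀ c : F, (∀ j ∈ S, ρ j ≠ c) ↔ c = s ∨ c = t := by
    intro c
    have : c ∈ Finset.univ \ S.image ρ ↔ c ∈ ({s, t} : Finset F) := by rw [hst2]
    simpa using this
  have hne : ∀ c : F, (c = s ∨ c = t) → ∀ j, j ≠ i → (m - c • n) (p j) ≠ 0 := by
    intro c hc j hj h
    by_cases hjk : j = k
    · subst hjk; simp [hmk, hnk] at h
    · refine (hmiss c).2 hc j ((hS j).2 ⟨hj, hjk⟩) ?_
      have := hnj j hj hjk
      simp only [LinearMap.sub_apply, LinearMap.smul_apply, smul_eq_mul] at h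
      simp only [ρ]
      field_simp
      linear_combination h
  refine ⟨m - s • n, m - t • n, by simp [hmi, hni], by simp [hmi, hni],
    fun j hj => ⟨hne s (Or.inl rfl) j hj, hne t (Or.inr rfl) j hj⟩, ?_, ?_⟩
  · intro x h1 h2
    simp only [LinearMap.sub_apply, LinearMap.smul_apply, smul_eq_mul] at h1 h2
    have h3 : n x = 0 := by
      have : (s - t) * n x = 0 := by linear_combination h2 - h1
      exact (mul_eq_zero.1 this).resolve_left (sub_ne_zero.2 hst)
    exact hker x (by simpa [h3] using h1) h3
  · intro c hc
    by_cases hc1 : c = 1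
    · exact ⟨k, hk, by simp [hmk, hnk, hc1]⟩
    have hc1' : 1 - c ≠ 0 := sub_ne_zero.2 (Ne.symm hc1)
    have hd : ¬ ((t - c * s) / (1 - c) = s ∨ (t - c * s) / (1 - c) = t) := by
      have hts : t - s ≠ 0 := sub_ne_zero.2 (Ne.symm hst)
      rintro (h | h)
      · rw [div_eq_iff hc1'] at h
        exact hts (by linear_combination h)
      · rw [div_eq_iff hc1'] at h
        exact mul_ne_zero hc hts (by linear_combination h)
    rw [← hmiss] at hd
    push Not at hd
    obtain ⟨j, hj, hj2⟩ := hd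
    have hj' := (hS j).1 hj
    refine ⟨j, hj'.1, ?_⟩
    have := hnj j hj'.1 hj'.2
    simp only [ρ] at hj2
    rw [div_eq_div_iff this hc1'] at hj2
    simp only [LinearMap.sub_apply, LinearMap.smul_apply, smul_eq_mul]
    linear_combination hj2

/-! ### Tangents of an arc in a plane, and cones over subspaces at infinity -/

section Plane

variable {F : Type u} [Field F] {V : Type v} [AddCommGroup V] [Module F V] {H : Submodule F V}
  {K : Set (ℙ F V)}

theorem submodule_le_iff (P : ℙ F V) (T : Submodule F V) : P.submodule ≤ T ↔ P.rep ∈ T := by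
  rw [P.submodule_eq, Submodule.span_singleton_le_iff_mem]

theorem rep_mem (P : ℙ F V) : P.rep ∈ P.submodule :=
  (submodule_le_iff P _).1 le_rfl

theorem mem_submodule_iff {P : ℙ F V} {x : V} : x ∈ P.submodule ↔ ∃ c : F, c • P.rep = x := by
  rw [P.submodule_eq, Submodule.mem_span_singleton]

/-- A subspace `T` in which `S` is a hyperplane is spanned by `S` and any `t` of `T` outside
`S`. -/
theorem exists_sub_smul_mem [FiniteDimensional F V] {S T : Submodule F V} {t x : V} (hST : S ≤ T)
    (hdim : Module.finrank F T = Module.finrank F S + 1) (ht : t ∈ T) (htS : t ∉ S) (hx : x ∈ T) :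
    ∃ c : F, x - c • t ∈ S := by
  have hsp : S ⊔ Submodule.span F {t} = T := by
    refine Submodule.eq_of_le_of_finrank_le
      (sup_le hST ((Submodule.span_singleton_le_iff_mem _ _).2 ht)) ?_
    have hlt : S < S ⊔ Submodule.span F {t} :=
      lt_of_le_of_ne le_sup_left (fun h => htS (by
        rw [h]; exact Submodule.mem_sup_right (Submodule.mem_span_singleton_self t)))
    have := Submodule.finrank_lt_finrank_of_lt hlt
    omega
  rw [← hsp] at hx
  obtain ⟨s, hs, y, hy, rfl⟩ := Submodule.mem_sup.1 hx
  obtain ⟨c, rfl⟩ := Submodule.mem_span_singleton.1 hy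
  exact ⟨c, by simpa using hs⟩

theorem IsArc.arcFamily (hK : IsArc H K) :
    ArcFamily (F := F) (fun P : K => (⟨P.1.rep, (submodule_le_iff _ _).1 (hK.1 _ P.2)⟩ : H)) where
  pair P Q hPQ := by
    have h := (Projectivization.independent_pair_iff_ne P.1 Q.1).2
      (fun h => hPQ (Subtype.ext h))
    rw [Projectivization.independent_iff] at h
    refine LinearIndependent.of_comp H.subtype ?_
    convert h using 1
    ext i
    fin_cases i <;> rfl
  triple P Q R hPQ hPR hQR c h1 h2 h3 := by
    have h := hK.2 P P.2 Q Q.2 R R.2 (fun h => hPQ (Subtype.ext h)) (fun h => hPR (Subtype.ext h))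
      (fun h => hQR (Subtype.ext h))
    have hle : H ≤ (LinearMap.ker c).map H.subtype := by
      refine h.ge.trans ?_
      refine sup_le (sup_le ?_ ?_) ?_ <;> rw [submodule_le_iff]
      · exact ⟨_, h1, rfl⟩
      · exact ⟨_, h2, rfl⟩
      · exact ⟨_, h3, rfl⟩
    ext ⟨x, hx⟩
    obtain ⟨y, hy, hyx⟩ := hle hx
    have : y = ⟨x, hx⟩ := Subtype.ext hyx
    rw [← this]
    simpa using hy

theorem finrank_inf_ker [FiniteDimensional F V] (hH : Module.finrank F H = 3)
    (c : Module.Dual F V) {x : V} (hx : x ∈ H) (hcx : c x ≠ 0) :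
    Module.finrank F (H ⊓ LinearMap.ker c : Submodule F V) = 2 := by
  have h0 : c.domRestrict H ≠ 0 := fun h => hcx (LinearMap.congr_fun h ⟨x, hx⟩)
  have h1 := Module.Dual.finrank_ker_add_one_of_ne_zero h0
  have h2 : H ⊓ LinearMap.ker c = (LinearMap.ker (c.domRestrict H)).map H.subtype := by
    ext y
    simp only [Submodule.mem_inf, LinearMap.mem_ker, Submodule.mem_map, Submodule.subtype_apply,
      LinearMap.domRestrict_apply]
    exact ⟨fun h => ⟨⟨y, h.1⟩, h.2, rfl⟩, by rintro ⟨z, hz, rfl⟩; exact ⟨z.2, hz⟩⟩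
  rw [h2, Submodule.finrank_map_subtype_eq]
  omega

/-- A linear form that vanishes at exactly one point of the arc cuts out a tangent. -/
theorem isTangent_of_form [FiniteDimensional F V] (hH : Module.finrank F H = 3)
    (hK : IsArc H K) {P Q : ℙ F V} (hP : P ∈ K) (hQ : Q ∈ K) (hQP : Q ≠ P) (c : Module.Dual F V)
    (hcP : c P.rep = 0) (hc : ∀ R ∈ K, R ≠ P → c R.rep ≠ 0) :
    IsTangent H K (H ⊓ LinearMap.ker c) := by
  refine ⟨finrank_inf_ker hH c ((submodule_le_iff _ _).1 (hK.1 Q hQ)) (hc Q hQ hQP), inf_le_left,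
    P, ⟨hP, le_inf (hK.1 P hP) ((submodule_le_iff _ _).2 hcP)⟩, ?_⟩
  rintro R ⟨hR, hRT⟩
  by_contra hRP
  exact hc R hR hRP ((submodule_le_iff _ _).1 (hRT.trans inf_le_right))

theorem IsTangent.unique {T : Submodule F V} (hT : IsTangent H K T) {P Q : ℙ F V} (hP : P ∈ K)
    (hQ : Q ∈ K) (hPT : P.submodule ≤ T) (hQT : Q.submodule ≤ T) : P = Q :=
  hT.2.2.unique ⟨hP, hPT⟩ ⟨hQ, hQT⟩

/-- Through each point of a `q`-arc there are exactly two tangents. -/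
theorem exists_two_tangents [Finite F] [FiniteDimensional F V] (hH : Module.finrank F H = 3)
    (hK : IsArc H K) (hcard : K.ncard = Nat.card F) {P : ℙ F V} (hP : P ∈ K) :
    ∃ T₁ T₂, T₁ ≠ T₂ ∧ ∀ T, IsTangent H K T ∧ P.submodule ≤ T ↔ T = T₁ ∨ T = T₂ := by
  obtain ⟨a, b, haP, hbP, hab, hker, hsurj⟩ := exists_tangent_forms hH hK.arcFamily
    (by rw [← hcard]; rfl) (⟨P, hP⟩ : K)
  obtain ⟨a, rfl⟩ := LinearMap.exists_extend a
  obtain ⟨b, rfl⟩ := LinearMap.exists_extend b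
  obtain ⟨⟨Q, hQ⟩, hQP, -⟩ := hsurj 1 one_ne_zero
  have hQP : Q ≠ P := fun h => hQP (Subtype.ext h)
  simp only [LinearMap.comp_apply, Submodule.subtype_apply] at haP hbP
  have ha : ∀ R ∈ K, R ≠ P → a R.rep ≠ 0 := fun R hR hRP =>
    (hab ⟨R, hR⟩ (fun h => hRP (Subtype.ext_iff.1 h))).1
  have hb : ∀ R ∈ K, R ≠ P → b R.rep ≠ 0 := fun R hR hRP =>
    (hab ⟨R, hR⟩ (fun h => hRP (Subtype.ext_iff.1 h))).2
  have hker : ∀ x ∈ H, a x = 0 → b x = 0 → x ∈ P.submodule := by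
    intro x hx h1 h2
    obtain ⟨c, hc⟩ := Submodule.mem_span_singleton.1 (hker ⟨x, hx⟩ h1 h2)
    exact mem_submodule_iff.2 ⟨c, Subtype.ext_iff.1 hc⟩
  have hTa := isTangent_of_form hH hK hP hQ hQP a haP ha
  have hTb := isTangent_of_form hH hK hP hQ hQP b hbP hb
  have hPa : P.submodule ≤ H ⊓ LinearMap.ker a :=
    le_inf (hK.1 P hP) ((submodule_le_iff _ _).2 haP)
  have hPb : P.submodule ≤ H ⊓ LinearMap.ker b :=
    le_inf (hK.1 P hP) ((submodule_le_iff _ _).2 hbP)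
  refine ⟨H ⊓ LinearMap.ker a, H ⊓ LinearMap.ker b, ?_, fun T => ⟨?_, ?_⟩⟩
  rotate_left
  · rintro ⟨hT, hPT⟩
    obtain ⟨t, ht, htP⟩ : ∃ t ∈ T, t ∉ P.submodule := by
      by_contra! h
      have := Submodule.finrank_mono (show T ≤ P.submodule from h)
      rw [hT.1, P.finrank_submodule] at this
      omega
    have key : ∀ c : Module.Dual F V, c P.rep = 0 →
        Module.finrank F (H ⊓ LinearMap.ker c : Submodule F V) = 2 → c t = 0 →
        T = H ⊓ LinearMap.ker c := by
      intro c hcP hc2 hct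
      refine Submodule.eq_of_le_of_finrank_eq (le_inf hT.2.1 ?_) (hT.1.trans hc2.symm)
      intro x hx
      obtain ⟨d, hd⟩ := exists_sub_smul_mem hPT (by rw [hT.1, P.finrank_submodule]) ht htP hx
      have hd' : c (x - d • t) = 0 := (submodule_le_iff P (LinearMap.ker c)).2 hcP hd
      simpa [hct] using hd'
    by_cases hat : a t = 0
    · exact Or.inl (key a haP hTa.1 hat)
    by_cases hbt : b t = 0
    · exact Or.inr (key b hbP hTb.1 hbt)
    exfalso
    -- otherwise `T` is the secant through the point at which `b / a` has the same value as at `t`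
    obtain ⟨⟨R, hR⟩, hRP, hRab⟩ := hsurj (b t / a t) (div_ne_zero hbt hat)
    have hRP : R ≠ P := fun h => hRP (Subtype.ext h)
    simp only [LinearMap.comp_apply, Submodule.subtype_apply] at hRab
    have hRH : R.rep ∈ H := (submodule_le_iff _ _).1 (hK.1 R hR)
    have h1 : R.rep - (a R.rep / a t) • t ∈ P.submodule := by
      refine hker _ (H.sub_mem hRH (H.smul_mem _ (hT.2.1 ht))) ?_ ?_
      · simp [hat]
      · simp only [map_sub, map_smul, smul_eq_mul, hRab]
        field_simp
        ring
    have h2 : R.rep ∈ T := by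
      have := T.add_mem (hPT h1) (T.smul_mem (a R.rep / a t) ht)
      rwa [sub_add_cancel] at this
    exact hRP (hT.unique hR hP ((submodule_le_iff _ _).2 h2) hPT)
  · rintro (rfl | rfl)
    exacts [⟨hTa, hPa⟩, ⟨hTb, hPb⟩]
  · intro h
    have hle : H ⊓ LinearMap.ker a ≤ P.submodule := fun x hx =>
      hker x hx.1 hx.2 (h ▸ hx : x ∈ H ⊓ LinearMap.ker b).2
    have := Submodule.finrank_mono hle
    rw [hTa.1, P.finrank_submodule] at this
    omega

end Plane

section Cone

variable {F : Type u} [Field F] {V : Type v} [AddCommGroup V] [Module F V]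
  {δ : Module.Dual F V} {S S' : Submodule F V} {u u' v : V}

/-- The projective subspace joining `S` to the point `u`. It is used for `S` in the plane
`δ = 0` at infinity and for an affine point `u`, normalised by `δ u = 1`: a subspace that is not at
infinity is given by its direction `S` and by a translation vector `u` modulo `S`. -/
def cone (S : Submodule F V) (u : V) : Submodule F V := S ⊔ Submodule.span F {u}

theorem mem_cone (hS : S ≤ LinearMap.ker δ) (hu : δ u = 1) : v ∈ cone S u ↔ v - δ v • u ∈ S := by
  constructor
  · intro h
    obtain ⟨s, hs, y, hy, rfl⟩ := Submodule.mem_sup.1 h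
    obtain ⟨c, rfl⟩ := Submodule.mem_span_singleton.1 hy
    have : δ s = 0 := hS hs
    simpa [this, hu] using hs
  · intro h
    rw [← sub_add_cancel v (δ v • u)]
    exact Submodule.add_mem_sup h (Submodule.smul_mem _ _ (Submodule.mem_span_singleton_self u))

theorem cone_le_cone (hS : S ≤ LinearMap.ker δ) (hS' : S' ≤ LinearMap.ker δ) (hu : δ u = 1)
    (hu' : δ u' = 1) : cone S u ≤ cone S' u' ↔ S ≤ S' ∧ u - u' ∈ S' := by
  rw [cone, sup_le_iff, Submodule.span_singleton_le_iff_mem, mem_cone hS' hu', hu, one_smul]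
  refine and_congr_left fun _ => ⟨fun h x hx => ?_, fun h x hx => ?_⟩
  · have h1 := (mem_cone hS' hu').1 (h hx)
    have h2 : δ x = 0 := hS hx
    simpa [h2] using h1
  · exact Submodule.mem_sup_left (h hx)

theorem cone_eq_cone (hS : S ≤ LinearMap.ker δ) (hS' : S' ≤ LinearMap.ker δ) (hu : δ u = 1)
    (hu' : δ u' = 1) : cone S u = cone S' u' ↔ S = S' ∧ u - u' ∈ S := by
  rw [le_antisymm_iff, cone_le_cone hS hS' hu hu', cone_le_cone hS' hS hu' hu, le_antisymm_iff]
  constructor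
  · rintro ⟨⟨h1, h2⟩, h3, h4⟩
    exact ⟨⟨h1, h3⟩, h3 h2⟩
  · rintro ⟨⟨h1, h2⟩, h3⟩
    exact ⟨⟨h1, h1 h3⟩, h2, by simpa using S.neg_mem h3⟩

theorem cone_not_le (hu : δ u = 1) : ¬ cone S u ≤ LinearMap.ker δ := by
  intro h
  have h1 : δ u = 0 :=
    h (Submodule.mem_sup_right (Submodule.mem_span_singleton_self u) : u ∈ cone S u)
  simp [h1] at hu

theorem finrank_cone [FiniteDimensional F V] (hS : S ≤ LinearMap.ker δ) (hu : δ u = 1) :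
    Module.finrank F (cone S u) = Module.finrank F S + 1 := by
  have hu0 : u ≠ 0 := by rintro rfl; simp at hu
  have hinf : S ⊓ Submodule.span F {u} = ⊥ := by
    rw [Submodule.eq_bot_iff]
    rintro x ⟨hx, hxu⟩
    obtain ⟨c, rfl⟩ := Submodule.mem_span_singleton.1 hxu
    have h1 : δ (c • u) = 0 := hS hx
    have : c = 0 := by simpa [hu] using h1
    simp [this]
  have h := Submodule.finrank_sup_add_finrank_inf_eq S (Submodule.span F {u})
  rw [hinf, finrank_bot, finrank_span_singleton hu0] at h
  exact h

theorem exists_eq_cone {W : Submodule F V} (hW : ¬ W ≤ LinearMap.ker δ) :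
    ∃ u, δ u = 1 ∧ W = cone (W ⊓ LinearMap.ker δ) u := by
  obtain ⟨w, hw, hδw⟩ := SetLike.not_le_iff_exists.1 hW
  have hδw : δ w ≠ 0 := hδw
  have hu : δ ((δ w)⁻¹ • w) = 1 := by simp [hδw]
  have huW := W.smul_mem (δ w)⁻¹ hw
  refine ⟨_, hu, le_antisymm (fun x hx => ?_) ?_⟩
  · rw [mem_cone inf_le_right hu]
    refine ⟨W.sub_mem hx (W.smul_mem _ huW), ?_⟩
    simp [hδw]
  · exact sup_le inf_le_left ((Submodule.span_singleton_le_iff_mem _ _).2 huW)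

end Cone

/-! ### The incidence structure in terms of directions and translation vectors -/

section Coordinates

variable {F : Type u} [Field F] {V : Type v} [AddCommGroup V] [Module F V]
  {δ : Module.Dual F V} {K : Set (ℙ F V)}

theorem sub_mem_ker (u w : {u : V // δ u = 1}) : (u - w : V) ∈ LinearMap.ker δ := by
  simp [u.2, w.2]

/-- The affine point represented by `u`. -/
def aff (u : {u : V // δ u = 1}) : AffinePoint (LinearMap.ker δ) :=
  ⟨Projectivization.mk F u.1 (by rintro h; simpa [h] using u.2), by
    rw [Projectivization.submodule_mk, Submodule.span_singleton_le_iff_mem]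
    intro h
    have h0 : δ u.1 = 0 := h
    simp [u.2] at h0⟩

theorem aff_submodule (u : {u : V // δ u = 1}) : (aff u).1.submodule = cone ⊥ u.1 := by
  rw [aff, Projectivization.submodule_mk, cone, bot_sup_eq]

theorem aff_injective : Function.Injective (aff (δ := δ)) := by
  intro u u' h
  have h1 : cone (⊥ : Submodule F V) u.1 = cone ⊥ u'.1 := by rw [← aff_submodule, ← aff_submodule, h]
  have := ((cone_eq_cone bot_le bot_le u.2 u'.2).1 h1).2
  exact Subtype.ext (sub_eq_zero.1 ((Submodule.mem_bot F).1 this))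

variable [FiniteDimensional F V]

/-- The projective line joining `P ∈ K` to the affine point `u`. -/
def pt (hK : IsArc (LinearMap.ker δ) K) (P : K) (u : {u : V // δ u = 1}) :
    QPoint (LinearMap.ker δ) K :=
  ⟨cone P.1.submodule u, by rw [finrank_cone (hK.1 P P.2) u.2, P.1.finrank_submodule],
    cone_not_le u.2, P, P.2, le_sup_left⟩

/-- The plane joining the tangent `T` to the affine point `u`. -/
def pl (T : {T // IsTangent (LinearMap.ker δ) K T}) (u : {u : V // δ u = 1}) :
    TangentPlane (LinearMap.ker δ) K :=
  ⟨cone T.1 u, by rw [finrank_cone T.2.2.1 u.2, T.2.1],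
    fun h => cone_not_le (S := T.1) u.2 h.le, T, T.2, le_sup_left⟩

theorem pt_eq_pt (hK : IsArc (LinearMap.ker δ) K) {P P' : K} {u u' : {u : V // δ u = 1}} :
    pt hK P u = pt hK P' u' ↔ P = P' ∧ (u - u' : V) ∈ P.1.submodule := by
  refine Subtype.ext_iff.trans ?_
  refine (cone_eq_cone (hK.1 P P.2) (hK.1 P' P'.2) u.2 u'.2).trans ?_
  rw [Projectivization.submodule_injective.eq_iff, Subtype.ext_iff]

theorem pl_eq_pl {T T' : {T // IsTangent (LinearMap.ker δ) K T}} {u u' : {u : V // δ u = 1}} :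
    pl T u = pl T' u' ↔ T = T' ∧ (u - u' : V) ∈ T.1 := by
  refine Subtype.ext_iff.trans ?_
  refine (cone_eq_cone T.2.2.1 T'.2.2.1 u.2 u'.2).trans ?_
  rw [Subtype.ext_iff]

theorem pt_surjective (hK : IsArc (LinearMap.ker δ) K) (l : QPoint (LinearMap.ker δ) K) :
    ∃ P u, l = pt hK P u := by
  obtain ⟨l, hl2, hl, P, hP, hPl⟩ := l
  obtain ⟨u, hu, hlu⟩ := exists_eq_cone hl
  refine ⟨⟨P, hP⟩, ⟨u, hu⟩, Subtype.ext ?_⟩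
  change l = cone P.submodule u
  rw [hlu, finrank_cone inf_le_right hu] at hl2
  rw [Submodule.eq_of_le_of_finrank_eq (le_inf hPl (hK.1 P hP))
    (by rw [P.finrank_submodule]; omega)]
  exact hlu

theorem aff_surjective (A : AffinePoint (LinearMap.ker δ)) : ∃ u, A = aff u := by
  obtain ⟨A, hA⟩ := A
  obtain ⟨u, hu, hAu⟩ := exists_eq_cone hA
  refine ⟨⟨u, hu⟩, Subtype.ext (Projectivization.submodule_injective ?_)⟩
  rw [aff_submodule]
  have h1 := A.finrank_submodule
  rw [hAu, finrank_cone inf_le_right hu] at h1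
  have h2 : A.submodule ⊓ LinearMap.ker δ = ⊥ := Submodule.finrank_eq_zero.1 (by omega)
  rwa [h2] at hAu

theorem pl_surjective (hH : Module.finrank F (LinearMap.ker δ) = 3)
    (E : TangentPlane (LinearMap.ker δ) K) : ∃ T u, E = pl T u := by
  obtain ⟨E, hE3, hEH, T, hT, hTE⟩ := E
  have hE : ¬ E ≤ LinearMap.ker δ := fun h =>
    hEH (Submodule.eq_of_le_of_finrank_eq h (hE3.trans hH.symm))
  obtain ⟨u, hu, hEu⟩ := exists_eq_cone hE
  refine ⟨⟨T, hT⟩, ⟨u, hu⟩, Subtype.ext ?_⟩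
  change E = cone T u
  rw [hEu, finrank_cone inf_le_right hu] at hE3
  rw [Submodule.eq_of_le_of_finrank_eq (le_inf hTE hT.2.1) (by rw [hT.1]; omega)]
  exact hEu

theorem inc_aff (hK : IsArc (LinearMap.ker δ) K) {P : K} {u w : {u : V // δ u = 1}} :
    QInc (LinearMap.ker δ) K (pt hK P u) (Sum.inl (aff w)) ↔ (w - u : V) ∈ P.1.submodule := by
  change (aff w).1.submodule ≤ cone P.1.submodule u.1 ↔ _
  rw [aff_submodule, cone_le_cone bot_le (hK.1 P P.2) w.2 u.2]
  simp

theorem inc_pl (hK : IsArc (LinearMap.ker δ) K) {P : K} {u w : {u : V // δ u = 1}}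
    {T : {T // IsTangent (LinearMap.ker δ) K T}} :
    QInc (LinearMap.ker δ) K (pt hK P u) (Sum.inr (pl T w)) ↔
      P.1.submodule ≤ T.1 ∧ (u - w : V) ∈ T.1 :=
  cone_le_cone (hK.1 P P.2) T.2.2.1 u.2 w.2

end Coordinates

/-! ### The generalised quadrangle -/

section Quadrangle

variable {F : Type u} [Field F] {V : Type v} [AddCommGroup V] [Module F V]

theorem eq_of_mem_submodule {P Q : ℙ F V} {x : V} (hx : x ≠ 0) (hP : x ∈ P.submodule)
    (hQ : x ∈ Q.submodule) : P = Q := by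
  have h : ∀ R : ℙ F V, x ∈ R.submodule → R = Projectivization.mk F x hx := by
    intro R hR
    obtain ⟨c, hc⟩ := mem_submodule_iff.1 hR
    rw [← R.mk_rep, Projectivization.mk_eq_mk_iff']
    have hc0 : c ≠ 0 := by rintro rfl; exact hx (by simpa using hc.symm)
    exact ⟨c⁻¹, by rw [← hc, smul_smul, inv_mul_cancel₀ hc0, one_smul]⟩
  rw [h P hP, h Q hQ]

theorem IsArc.eq_or_eq [FiniteDimensional F V] {H : Submodule F V} {K : Set (ℙ F V)}
    (hK : IsArc H K) (hH : Module.finrank F H = 3) {L : Submodule F V}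
    (hL : Module.finrank F L = 2) {P Q R : ℙ F V} (hP : P ∈ K) (hQ : Q ∈ K) (hR : R ∈ K)
    (hPQ : P ≠ Q) (hPL : P.submodule ≤ L) (hQL : Q.submodule ≤ L) (hRL : R.submodule ≤ L) :
    R = P ∨ R = Q := by
  by_contra! h
  have := Submodule.finrank_mono (sup_le (sup_le hPL hQL) hRL)
  rw [hK.2 P hP Q hQ R hR hPQ h.1.symm h.2.symm] at this
  omega

theorem isTangent_or_exists {H : Submodule F V} {K : Set (ℙ F V)} {L : Submodule F V}
    (hL : Module.finrank F L = 2) (hLH : L ≤ H) {P : ℙ F V} (hP : P ∈ K) (hPL : P.submodule ≤ L) :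
    IsTangent H K L ∨ ∃ Q ∈ K, Q ≠ P ∧ Q.submodule ≤ L := by
  by_cases h : ∃ Q ∈ K, Q ≠ P ∧ Q.submodule ≤ L
  · exact Or.inr h
  · push Not at h
    refine Or.inl ⟨hL, hLH, P, ⟨hP, hPL⟩, fun Q hQ => ?_⟩
    by_contra hQP
    exact h Q hQ.1 hQP hQ.2

variable [FiniteDimensional F V] {δ : Module.Dual F V} {K : Set (ℙ F V)}

theorem mem_submodule_of_mem_of_mem {S S' : Submodule F V} (hS : Module.finrank F S = 2)
    (hS' : Module.finrank F S' = 2) (hne : S ≠ S') {P : ℙ F V} (hP : P.submodule ≤ S)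
    (hP' : P.submodule ≤ S') {x : V} (hx : x ∈ S) (hx' : x ∈ S') : x ∈ P.submodule := by
  by_contra hxP
  refine hne (Submodule.eq_of_le_of_finrank_eq (fun y hy => ?_) (hS.trans hS'.symm))
  obtain ⟨c, hc⟩ := exists_sub_smul_mem hP (by rw [hS, P.finrank_submodule]) hx hxP hy
  simpa using S'.add_mem (hP' hc) (S'.smul_mem c hx')

/-- The incidence structure contains no digon. -/
theorem eq_or_eq_of_inc (hH : Module.finrank F (LinearMap.ker δ) = 3)
    (hK : IsArc (LinearMap.ker δ) K) {p p' : QPoint (LinearMap.ker δ) K}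
    {l l' : QLine (LinearMap.ker δ) K} (h1 : QInc _ K p l) (h2 : QInc _ K p' l)
    (h3 : QInc _ K p l') (h4 : QInc _ K p' l') : p = p' ∨ l = l' := by
  obtain ⟨P, u, rfl⟩ := pt_surjective hK p
  obtain ⟨P', u', rfl⟩ := pt_surjective hK p'
  have affpl : ∀ w T v, QInc _ K (pt hK P u) (Sum.inl (aff w)) →
      QInc _ K (pt hK P' u') (Sum.inl (aff w)) → QInc _ K (pt hK P u) (Sum.inr (pl T v)) →
      QInc _ K (pt hK P' u') (Sum.inr (pl T v)) → pt hK P u = pt hK P' u' := by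
    intro w T v h1 h2 h3 h4
    rw [inc_aff] at h1 h2
    rw [inc_pl] at h3 h4
    obtain rfl : P = P' := Subtype.ext (T.2.unique P.2 P'.2 h3.1 h4.1)
    exact (pt_eq_pt hK).2 ⟨rfl, by simpa using Submodule.sub_mem _ h2 h1⟩
  rcases l with A | E <;> rcases l' with A' | E'
  · obtain ⟨w, rfl⟩ := aff_surjective A
    obtain ⟨w', rfl⟩ := aff_surjective A'
    rw [inc_aff] at h1 h2 h3 h4
    by_cases hw : (w - w' : V) = 0
    · right
      rw [Subtype.ext (sub_eq_zero.1 hw)]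
    · left
      obtain rfl : P = P' := Subtype.ext (eq_of_mem_submodule hw
        (by simpa using Submodule.sub_mem _ h1 h3) (by simpa using Submodule.sub_mem _ h2 h4))
      exact (pt_eq_pt hK).2 ⟨rfl, by simpa using Submodule.sub_mem _ h2 h1⟩
  · obtain ⟨w, rfl⟩ := aff_surjective A
    obtain ⟨T, v, rfl⟩ := pl_surjective hH E'
    exact Or.inl (affpl w T v h1 h2 h3 h4)
  · obtain ⟨w, rfl⟩ := aff_surjective A'
    obtain ⟨T, v, rfl⟩ := pl_surjective hH E
    exact Or.inl (affpl w T v h3 h4 h1 h2)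
  · obtain ⟨T, v, rfl⟩ := pl_surjective hH E
    obtain ⟨T', v', rfl⟩ := pl_surjective hH E'
    rw [inc_pl] at h1 h2 h3 h4
    obtain rfl : P = P' := Subtype.ext (T.2.unique P.2 P'.2 h1.1 h2.1)
    by_cases hT : T = T'
    · subst hT
      right
      rw [pl_eq_pl.2 ⟨rfl, by simpa using Submodule.sub_mem _ h3.2 h1.2⟩]
    · left
      refine (pt_eq_pt hK).2 ⟨rfl, ?_⟩
      exact mem_submodule_of_mem_of_mem T.2.1 T'.2.1 (fun h => hT (Subtype.ext h)) h1.1 h3.1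
        (by simpa using Submodule.sub_mem _ h1.2 h2.2) (by simpa using Submodule.sub_mem _ h3.2 h4.2)

theorem ncard_points_aff (hK : IsArc (LinearMap.ker δ) K) (w : {u : V // δ u = 1}) :
    {p | QInc _ K p (Sum.inl (aff w))}.ncard = K.ncard := by
  have h : {p | QInc _ K p (Sum.inl (aff w))} = Set.range (fun P : K => pt hK P w) := by
    ext p
    obtain ⟨P, u, rfl⟩ := pt_surjective hK p
    simp only [Set.mem_ofPred_eq, Set.mem_range, inc_aff, pt_eq_pt]
    exact ⟨fun h => ⟨P, rfl, h⟩, fun ⟨P', h⟩ => h.1 ▸ h.2⟩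
  rw [h, Set.ncard_def, ← Set.image_univ, ← Set.ncard_def,
    Set.ncard_image_of_injective _ (fun P P' h => ((pt_eq_pt hK).1 h).1), Set.ncard_univ]
  rfl

theorem ncard_points_pl (hK : IsArc (LinearMap.ker δ) K)
    (T : {T // IsTangent (LinearMap.ker δ) K T}) (w : {u : V // δ u = 1}) :
    {p | QInc _ K p (Sum.inr (pl T w))}.ncard = Nat.card F := by
  obtain ⟨P, hP, hPT⟩ := T.2.2.2.exists
  obtain ⟨t, ht, htP⟩ : ∃ t ∈ T.1, t ∉ P.submodule := by
    by_contra! h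
    have := Submodule.finrank_mono (show T.1 ≤ P.submodule from h)
    rw [T.2.1, P.finrank_submodule] at this
    omega
  have hδt : δ t = 0 := T.2.2.1 ht
  let f : F → QPoint (LinearMap.ker δ) K := fun c =>
    pt hK ⟨P, hP⟩ ⟨w + c • t, by simp [hδt, w.2]⟩
  have h : {p | QInc _ K p (Sum.inr (pl T w))} = Set.range f := by
    ext p
    obtain ⟨Q, u, rfl⟩ := pt_surjective hK p
    simp only [Set.mem_ofPred_eq, Set.mem_range, inc_pl, f, pt_eq_pt]
    constructor
    · rintro ⟨h1, h2⟩
      obtain rfl : ⟨P, hP⟩ = Q := Subtype.ext (T.2.unique hP Q.2 hPT h1)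
      obtain ⟨c, hc⟩ := exists_sub_smul_mem hPT (by rw [T.2.1, P.finrank_submodule]) ht htP h2
      exact ⟨c, rfl, by
        have := P.submodule.neg_mem hc
        convert this using 1
        abel⟩
    · rintro ⟨c, rfl, h⟩
      refine ⟨hPT, ?_⟩
      have := T.1.sub_mem (T.1.smul_mem c ht) (hPT h)
      convert this using 1
      abel
  have hf : Function.Injective f := by
    intro c c' hcc
    have := ((pt_eq_pt hK).1 hcc).2
    have h1 : (c - c') • t ∈ P.submodule := by
      convert this using 1
      rw [sub_smul]; simp only; abel
    by_contra hne
    exact htP ((Submodule.smul_mem_iff _ (sub_ne_zero.2 hne)).1 h1)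
  rw [h, ← Set.image_univ, Set.ncard_image_of_injective _ hf, Set.ncard_univ]

theorem ncard_lines [Finite F] (hH : Module.finrank F (LinearMap.ker δ) = 3)
    (hK : IsArc (LinearMap.ker δ) K) (hcard : K.ncard = Nat.card F)
    (p : QPoint (LinearMap.ker δ) K) : {l | QInc _ K p l}.ncard = Nat.card F + 2 := by
  obtain ⟨P, u, rfl⟩ := pt_surjective hK p
  obtain ⟨T₁, T₂, hne, hT⟩ := exists_two_tangents hH hK hcard P.2
  have hT₁ := (hT T₁).2 (Or.inl rfl)
  have hT₂ := (hT T₂).2 (Or.inr rfl)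
  have hδ : δ P.1.rep = 0 := (submodule_le_iff _ _).1 (hK.1 P P.2)
  let f : F → QLine (LinearMap.ker δ) K := fun c =>
    Sum.inl (aff ⟨u + c • P.1.rep, by simp [hδ, u.2]⟩)
  have hf : Function.Injective f := by
    intro c c' h
    have h1 := Subtype.ext_iff.1 (aff_injective (Sum.inl_injective h))
    simp only [add_right_inj] at h1
    exact smul_left_injective F P.1.rep_nonzero h1
  have h : {l | QInc _ K (pt hK P u) l} =
      Set.range f ∪ {Sum.inr (pl ⟨T₁, hT₁.1⟩ u), Sum.inr (pl ⟨T₂, hT₂.1⟩ u)} := by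
    ext l
    rcases l with A | E
    · obtain ⟨w, rfl⟩ := aff_surjective A
      simp only [Set.mem_ofPred_eq, inc_aff, Set.mem_union, Set.mem_range, Set.mem_insert_iff,
        Set.mem_singleton_iff, reduceCtorEq, or_false, f, Sum.inl.injEq, mem_submodule_iff,
        aff_injective.eq_iff, Subtype.ext_iff, eq_sub_iff_add_eq']
    · obtain ⟨T, w, rfl⟩ := pl_surjective hH E
      simp only [Set.mem_ofPred_eq, inc_pl, Set.mem_union, Set.mem_range, Set.mem_insert_iff,
        Set.mem_singleton_iff, reduceCtorEq, exists_false, false_or, f, Sum.inr.injEq, pl_eq_pl]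
      constructor
      · rintro ⟨h1, h2⟩
        have h3 : (w - u : V) ∈ T.1 := by simpa using T.1.neg_mem h2
        exact ((hT T).1 ⟨T.2, h1⟩).imp (fun h => ⟨Subtype.ext h, h3⟩)
          (fun h => ⟨Subtype.ext h, h3⟩)
      · rintro (⟨rfl, h⟩ | ⟨rfl, h⟩)
        · exact ⟨hT₁.2, by simpa using T₁.neg_mem h⟩
        · exact ⟨hT₂.2, by simpa using T₂.neg_mem h⟩
  have hdisj : Disjoint (Set.range f)
      {Sum.inr (pl ⟨T₁, hT₁.1⟩ u), Sum.inr (pl ⟨T₂, hT₂.1⟩ u)} := by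
    rw [Set.disjoint_left]
    rintro _ ⟨c, rfl⟩
    simp [f]
  have hne' : (Sum.inr (pl ⟨T₁, hT₁.1⟩ u) : QLine (LinearMap.ker δ) K) ≠
      Sum.inr (pl ⟨T₂, hT₂.1⟩ u) := fun h =>
    hne (Subtype.ext_iff.1 (pl_eq_pl.1 (Sum.inr_injective h)).1)
  rw [h, Set.ncard_union_eq hdisj (Set.finite_range f) (Set.toFinite _), Set.ncard_pair hne',
    ← Set.image_univ, Set.ncard_image_of_injective _ hf, Set.ncard_univ]

/-- The projection axiom for an affine point `w`: in the plane joining `w` to the line `p`, look at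
the line at infinity. It is either a secant of the arc through a second point `Q`, and then `Q w`
meets `p`; or it is a tangent, and the plane belongs to the structure. -/
theorem existsUnique_aff (hH : Module.finrank F (LinearMap.ker δ) = 3)
    (hK : IsArc (LinearMap.ker δ) K) (p : QPoint (LinearMap.ker δ) K) (w : {u : V // δ u = 1})
    (h : ¬ QInc _ K p (Sum.inl (aff w))) :
    ∃! x : QPoint (LinearMap.ker δ) K × QLine (LinearMap.ker δ) K,
      QInc _ K p x.2 ∧ QInc _ K x.1 x.2 ∧ QInc _ K x.1 (Sum.inl (aff w)) := by
  obtain ⟨P, u, rfl⟩ := pt_surjective hK p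
  rw [inc_aff] at h
  set d : V := w - u with hd
  have hdH : d ∈ LinearMap.ker δ := sub_mem_ker w u
  have hd0 : d ≠ 0 := by intro h0; rw [h0] at h; exact h (Submodule.zero_mem _)
  let L : Submodule F V := P.1.submodule ⊔ Submodule.span F {d}
  have hPL : P.1.submodule ≤ L := le_sup_left
  have hdL : d ∈ L := Submodule.mem_sup_right (Submodule.mem_span_singleton_self d)
  have hLH : L ≤ LinearMap.ker δ :=
    sup_le (hK.1 P P.2) ((Submodule.span_singleton_le_iff_mem _ _).2 hdH)
  have hL : Module.finrank F L = 2 := by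
    have hinf : P.1.submodule ⊓ Submodule.span F {d} = ⊥ := by
      rw [Submodule.eq_bot_iff]
      rintro x ⟨hx, hxd⟩
      obtain ⟨c, rfl⟩ := Submodule.mem_span_singleton.1 hxd
      by_contra hc
      exact h ((Submodule.smul_mem_iff _ (by rintro rfl; simp at hc)).1 hx)
    have := Submodule.finrank_sup_add_finrank_inf_eq P.1.submodule (Submodule.span F {d})
    rw [hinf, finrank_bot, finrank_span_singleton hd0, P.1.finrank_submodule] at this
    exact this
  -- every solution is of the form `(Q w, M)`
  have hshape : ∀ y M, QInc _ K (pt hK P u) M → QInc _ K y M → QInc _ K y (Sum.inl (aff w)) →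
      ∃ Q : K, y = pt hK Q w ∧ ((∃ m : {u : V // δ u = 1}, M = Sum.inl (aff m) ∧
        (m - u : V) ∈ P.1.submodule ∧ (m - w : V) ∈ Q.1.submodule ∧ Q ≠ P ∧ Q.1.submodule ≤ L) ∨
        Q = P ∧ ∃ T, M = Sum.inr (pl T u) ∧ T.1 = L) := by
    intro y M h1 h2 h3
    obtain ⟨Q, v, rfl⟩ := pt_surjective hK y
    rw [inc_aff] at h3
    have hy : pt hK Q v = pt hK Q w :=
      (pt_eq_pt hK).2 ⟨rfl, by simpa using Q.1.submodule.neg_mem h3⟩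
    rw [hy] at h2 ⊢
    refine ⟨Q, rfl, ?_⟩
    rcases M with A | E
    · obtain ⟨m, rfl⟩ := aff_surjective A
      rw [inc_aff] at h1 h2
      have hdm : d = (m - u : V) - (m - w : V) := by rw [hd]; abel
      have hm0 : (m - w : V) ≠ 0 := by
        intro h0; rw [h0, sub_zero] at hdm; rw [hdm] at h; exact h h1
      refine Or.inl ⟨m, rfl, h1, h2, ?_, ?_⟩
      · rintro rfl
        exact h (hdm ▸ Submodule.sub_mem _ h1 h2)
      · have hmL : (m - w : V) ∈ L := by
          have := L.sub_mem (hPL h1) hdL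
          rwa [hdm, sub_sub_cancel] at this
        obtain ⟨c, hc⟩ := mem_submodule_iff.1 h2
        rw [submodule_le_iff]
        rw [← hc] at hmL hm0
        exact (Submodule.smul_mem_iff _ (by rintro rfl; simp at hm0)).1 hmL
    · obtain ⟨T, v, rfl⟩ := pl_surjective hH E
      rw [inc_pl] at h1 h2
      have hdT : d ∈ T.1 := by
        have := T.1.sub_mem h2.2 h1.2
        rwa [sub_sub_sub_cancel_right] at this
      refine Or.inr ⟨Subtype.ext (T.2.unique Q.2 P.2 h2.1 h1.1), T, ?_, ?_⟩
      · rw [pl_eq_pl.2 ⟨rfl, by simpa using T.1.neg_mem h1.2⟩]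
      · exact (Submodule.eq_of_le_of_finrank_eq
          (sup_le h1.1 ((Submodule.span_singleton_le_iff_mem _ _).2 hdT))
          (hL.trans T.2.1.symm)).symm
  rcases isTangent_or_exists hL hLH P.2 hPL with hT | ⟨Q, hQ, hQP, hQL⟩
  · refine ⟨(pt hK P w, Sum.inr (pl ⟨L, hT⟩ u)), ⟨?_, ?_, ?_⟩, ?_⟩
    · exact (inc_pl hK).2 ⟨hPL, by simp⟩
    · exact (inc_pl hK).2 ⟨hPL, hdL⟩
    · exact (inc_aff hK).2 (by simp)
    · rintro ⟨y, M⟩ ⟨h1, h2, h3⟩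
      obtain ⟨Q, rfl, ⟨m, -, -, -, hQP, hQL⟩ | ⟨rfl, T, rfl, hTL⟩⟩ := hshape y M h1 h2 h3
      · exact absurd (Subtype.ext (hT.unique Q.2 P.2 hQL hPL)) hQP
      · obtain rfl : T = ⟨L, hT⟩ := Subtype.ext hTL
        rfl
  · have hQnP : Q.rep ∉ P.1.submodule := fun hmem =>
      hQP (eq_of_mem_submodule Q.rep_nonzero (rep_mem Q) hmem)
    obtain ⟨c, hc⟩ := exists_sub_smul_mem hPL (by rw [hL, P.1.finrank_submodule])
      ((submodule_le_iff _ _).1 hQL) hQnP hdL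
    have hδQ : δ Q.rep = 0 := (submodule_le_iff _ _).1 (hK.1 Q hQ)
    let m : {u : V // δ u = 1} := ⟨w - c • Q.rep, by simp [w.2, hδQ]⟩
    have hmu : (m - u : V) ∈ P.1.submodule := by
      convert hc using 1
      simp only [m, d]; abel
    have hmw : (m - w : V) ∈ Q.submodule := by
      have : (m - w : V) = (-c) • Q.rep := by simp [m]
      rw [this]
      exact Submodule.smul_mem _ _ (rep_mem Q)
    refine ⟨(pt hK ⟨Q, hQ⟩ w, Sum.inl (aff m)), ⟨?_, ?_, ?_⟩, ?_⟩
    · exact (inc_aff hK).2 hmu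
    · exact (inc_aff hK).2 hmw
    · exact (inc_aff hK).2 (by simp)
    · rintro ⟨y, M⟩ ⟨h1, h2, h3⟩
      obtain ⟨R, rfl, ⟨m', rfl, hm'u, hm'w, hRP, hRL⟩ | ⟨rfl, T, rfl, hTL⟩⟩ := hshape y M h1 h2 h3
      · have hRQ : R.1 = Q := (hK.eq_or_eq hH hL P.2 hQ R.2 (Ne.symm hQP) hPL hQL hRL).resolve_left
          (fun h => hRP (Subtype.ext h))
        obtain rfl : R = ⟨Q, hQ⟩ := Subtype.ext hRQ
        have : (m' - m : V) = 0 := by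
          by_contra h0
          exact hQP (eq_of_mem_submodule h0 (by simpa using Submodule.sub_mem _ hm'w hmw)
            (by simpa using Submodule.sub_mem _ hm'u hmu))
        rw [Subtype.ext (sub_eq_zero.1 this)]
      · exact absurd (T.2.unique hQ R.2 (hTL ▸ hQL) (hTL ▸ hPL)) hQP

/-- The projection axiom for a plane `E` of the structure, with tangent `T` at `Q`, and a line `p`
through `P ∈ K`: if `P ≠ Q`, then `p` meets `E` in an affine point, which is to be joined to `Q`;
if `P = Q`, then the plane joining `p` to the second tangent at `P` has to be intersected
with `E`. -/
theorem existsUnique_pl [Finite F] (hH : Module.finrank F (LinearMap.ker δ) = 3)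
    (hK : IsArc (LinearMap.ker δ) K) (hcard : K.ncard = Nat.card F)
    (p : QPoint (LinearMap.ker δ) K)
    (T : {T // IsTangent (LinearMap.ker δ) K T}) (w : {u : V // δ u = 1})
    (h : ¬ QInc _ K p (Sum.inr (pl T w))) :
    ∃! x : QPoint (LinearMap.ker δ) K × QLine (LinearMap.ker δ) K,
      QInc _ K p x.2 ∧ QInc _ K x.1 x.2 ∧ QInc _ K x.1 (Sum.inr (pl T w)) := by
  obtain ⟨P, u, rfl⟩ := pt_surjective hK p
  rw [inc_pl, not_and] at h
  by_cases hPT : P.1.submodule ≤ T.1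
  · have hd := h hPT
    obtain ⟨T', hT', hPT', hne, hother⟩ : ∃ T', ∃ _ : IsTangent (LinearMap.ker δ) K T',
        P.1.submodule ≤ T' ∧ T.1 ≠ T' ∧ ∀ S, IsTangent (LinearMap.ker δ) K S →
          P.1.submodule ≤ S → S ≠ T.1 → S = T' := by
      obtain ⟨T₁, T₂, hne, hT⟩ := exists_two_tangents hH hK hcard P.2
      have hT₁ := (hT T₁).2 (Or.inl rfl)
      have hT₂ := (hT T₂).2 (Or.inr rfl)
      rcases (hT T.1).1 ⟨T.2, hPT⟩ with h1 | h1
      · exact ⟨T₂, hT₂.1, hT₂.2, h1 ▸ hne, fun S hS hPS hST =>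
          ((hT S).1 ⟨hS, hPS⟩).resolve_left (fun h => hST (h.trans h1.symm))⟩
      · exact ⟨T₁, hT₁.1, hT₁.2, h1 ▸ hne.symm, fun S hS hPS hST =>
          ((hT S).1 ⟨hS, hPS⟩).resolve_right (fun h => hST (h.trans h1.symm))⟩
    obtain ⟨t, ht, htT⟩ : ∃ t ∈ T', t ∉ T.1 := by
      by_contra! h
      exact hne (Submodule.eq_of_le_of_finrank_eq (show T' ≤ T.1 from h)
        (hT'.1.trans T.2.1.symm)).symm
    obtain ⟨c, hc⟩ := exists_sub_smul_mem T.2.2.1 (by rw [hH, T.2.1]) (hT'.2.1 ht) htT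
      (sub_mem_ker u w)
    have hδt : δ t = 0 := hT'.2.1 ht
    let v : {u : V // δ u = 1} := ⟨u - c • t, by simp [u.2, hδt]⟩
    have hvw : (v - w : V) ∈ T.1 := by
      convert hc using 1
      simp only [v]; abel
    have hvu : (v - u : V) ∈ T' := by
      have : (v - u : V) = (-c) • t := by simp [v]
      rw [this]
      exact Submodule.smul_mem _ _ ht
    refine ⟨(pt hK P v, Sum.inr (pl ⟨T', hT'⟩ u)), ⟨?_, ?_, ?_⟩, ?_⟩
    · exact (inc_pl hK).2 ⟨hPT', by simp⟩
    · exact (inc_pl hK).2 ⟨hPT', hvu⟩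
    · exact (inc_pl hK).2 ⟨hPT, hvw⟩
    · rintro ⟨y, M⟩ ⟨h1, h2, h3⟩
      obtain ⟨R, v', rfl⟩ := pt_surjective hK y
      dsimp only at h1 h2 h3
      rw [inc_pl] at h3
      obtain rfl : R = P := Subtype.ext (T.2.unique R.2 P.2 h3.1 hPT)
      rcases M with A | E
      · obtain ⟨m, rfl⟩ := aff_surjective A
        rw [inc_aff] at h1 h2
        refine absurd ?_ hd
        have := T.1.add_mem (hPT (Submodule.sub_mem _ h2 h1)) h3.2
        simpa using this
      · obtain ⟨S, m, rfl⟩ := pl_surjective hH E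
        rw [inc_pl] at h1 h2
        have hvu' : (v' - u : V) ∈ S.1 := by simpa using Submodule.sub_mem _ h2.2 h1.2
        have hST : S.1 ≠ T.1 := by
          intro hST
          rw [hST] at hvu'
          exact hd (by simpa using T.1.sub_mem h3.2 hvu')
        obtain rfl : S = ⟨T', hT'⟩ := Subtype.ext (hother S.1 S.2 h1.1 hST)
        have hvv : (v' - v : V) ∈ R.1.submodule :=
          mem_submodule_of_mem_of_mem T.2.1 hT'.1 hne hPT hPT'
            (by simpa using T.1.sub_mem h3.2 hvw) (by simpa using Submodule.sub_mem _ hvu' hvu)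
        rw [(pt_eq_pt hK).2 ⟨rfl, hvv⟩, pl_eq_pl.2 ⟨rfl, by simpa using T'.neg_mem h1.2⟩]
  · obtain ⟨Q, hQ, hQT⟩ := T.2.2.2.exists
    obtain ⟨c, hc⟩ := exists_sub_smul_mem T.2.2.1 (by rw [hH, T.2.1])
      ((submodule_le_iff _ _).1 (hK.1 P P.2)) (fun h => hPT ((submodule_le_iff _ _).2 h))
      (sub_mem_ker u w)
    have hδP : δ P.1.rep = 0 := (submodule_le_iff _ _).1 (hK.1 P P.2)
    let m : {u : V // δ u = 1} := ⟨u - c • P.1.rep, by simp [u.2, hδP]⟩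
    have hmu : (m - u : V) ∈ P.1.submodule := by
      have : (m - u : V) = (-c) • P.1.rep := by simp [m]
      rw [this]
      exact Submodule.smul_mem _ _ (rep_mem _)
    have hmw : (m - w : V) ∈ T.1 := by
      convert hc using 1
      simp only [m]; abel
    refine ⟨(pt hK ⟨Q, hQ⟩ m, Sum.inl (aff m)), ⟨?_, ?_, ?_⟩, ?_⟩
    · exact (inc_aff hK).2 hmu
    · exact (inc_aff hK).2 (by simp)
    · exact (inc_pl hK).2 ⟨hQT, hmw⟩
    · rintro ⟨y, M⟩ ⟨h1, h2, h3⟩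
      obtain ⟨R, v, rfl⟩ := pt_surjective hK y
      dsimp only at h1 h2 h3
      rw [inc_pl] at h3
      obtain rfl : R = ⟨Q, hQ⟩ := Subtype.ext (T.2.unique R.2 hQ h3.1 hQT)
      rcases M with A | E
      · obtain ⟨m', rfl⟩ := aff_surjective A
        rw [inc_aff] at h1 h2
        have hmm : (m' - m : V) = 0 := by
          have h4 : (m' - m : V) ∈ P.1.submodule := by simpa using Submodule.sub_mem _ h1 hmu
          have h5 : (m' - m : V) ∈ T.1 := by
            have := T.1.sub_mem (T.1.add_mem (hQT h2) h3.2) hmw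
            simpa using this
          obtain ⟨e, he⟩ := mem_submodule_iff.1 h4
          by_contra h0
          rw [← he] at h5 h0
          exact hPT ((submodule_le_iff _ _).2
            ((Submodule.smul_mem_iff _ (by rintro rfl; simp at h0)).1 h5))
        obtain rfl : m' = m := Subtype.ext (sub_eq_zero.1 hmm)
        rw [(pt_eq_pt hK).2 ⟨rfl, by simpa using Submodule.neg_mem _ h2⟩]
      · obtain ⟨T', v', rfl⟩ := pl_surjective hH E
        rw [inc_pl] at h1 h2
        have hPQ := T'.2.unique P.2 hQ h1.1 h2.1
        exact absurd (hPQ ▸ hQT) hPT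

theorem isGQ [Finite F] (hH : Module.finrank F (LinearMap.ker δ) = 3) (hδ : ∃ u, δ u = 1)
    (hK : IsArc (LinearMap.ker δ) K) (hcard : K.ncard = Nat.card F) :
    IsGQ (QInc (LinearMap.ker δ) K) (Nat.card F - 1) (Nat.card F + 1) := by
  have hF : 1 < Nat.card F := Finite.one_lt_card
  obtain ⟨u, hu⟩ := hδ
  obtain ⟨P, hP⟩ : K.Nonempty := Set.nonempty_of_ncard_ne_zero (by omega)
  refine ⟨⟨pt hK ⟨P, hP⟩ ⟨u, hu⟩⟩, ⟨Sum.inl (aff ⟨u, hu⟩)⟩, by omega, by omega, ?_, ?_, ?_, ?_, ?_⟩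
  · rintro (A | E)
    · obtain ⟨w, rfl⟩ := aff_surjective A
      rw [ncard_points_aff hK, hcard]; omega
    · obtain ⟨T, w, rfl⟩ := pl_surjective hH E
      rw [ncard_points_pl hK]; omega
  · exact fun p => ncard_lines hH hK hcard p
  · exact fun p p' hne l l' h1 h2 h3 h4 => (eq_or_eq_of_inc hH hK h1 h2 h3 h4).resolve_left hne
  · exact fun l l' hne p p' h1 h2 h3 h4 => (eq_or_eq_of_inc hH hK h1 h3 h2 h4).resolve_right hne
  · rintro p (A | E) h
    · obtain ⟨w, rfl⟩ := aff_surjective A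
      exact existsUnique_aff hH hK p w h
    · obtain ⟨T, w, rfl⟩ := pl_surjective hH E
      exact existsUnique_pl hH hK hcard p T w h

end Quadrangle

/-! ### The lemma of tangents -/

section Segre

variable {F : Type u} [Field F]

/-- The determinant of three vectors of `F³`. -/
def det3 (u v w : Fin 3 → F) : F :=
  u 0 * (v 1 * w 2 - v 2 * w 1) + u 1 * (v 2 * w 0 - v 0 * w 2) + u 2 * (v 0 * w 1 - v 1 * w 0)

theorem dual_apply (a : Module.Dual F (Fin 3 → F)) (x : Fin 3 → F) :
    a x = a (Pi.single 0 1) * x 0 + a (Pi.single 1 1) * x 1 + a (Pi.single 2 1) * x 2 := by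
  have h := LinearMap.pi_apply_eq_sum_univ a x
  rw [Fin.sum_univ_three] at h
  rw [h]
  have : ∀ i : Fin 3, (fun j => if i = j then (1 : F) else 0) = Pi.single i 1 := by
    intro i; ext j; simp [Pi.single_apply, eq_comm]
  simp only [this, smul_eq_mul]
  ring

/-- The linear form `x ↦ det3 u v x`. -/
def det3Form (u v : Fin 3 → F) : Module.Dual F (Fin 3 → F) where
  toFun x := det3 u v x
  map_add' x y := by simp only [det3, Pi.add_apply]; ring
  map_smul' c x := by simp only [det3, Pi.smul_apply, smul_eq_mul, RingHom.id_apply]; ring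

theorem det3_self_left (u v : Fin 3 → F) : det3 u v u = 0 := by simp only [det3]; ring

theorem det3_self_right (u v : Fin 3 → F) : det3 u v v = 0 := by simp only [det3]; ring

theorem det3_reverse (u v w : Fin 3 → F) : det3 w v u = -det3 u v w := by simp only [det3]; ring

variable {ι : Type*} {p : ι → Fin 3 → F}

theorem ArcFamily.det3_ne_zero (hp : ArcFamily (F := F) p) {i j k : ι} (hij : i ≠ j) (hik : i ≠ k)
    (hjk : j ≠ k) : det3 (p i) (p j) (p k) ≠ 0 := by
  intro h
  have h0 : det3Form (p i) (p j) = 0 := hp.triple i j k hij hik hjk _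
    (det3_self_left _ _) (det3_self_right _ _) h
  have h1 : ∀ x, det3 (p i) (p j) x = 0 := fun x => LinearMap.congr_fun h0 x
  have e0 := h1 (Pi.single 0 1)
  have e1 := h1 (Pi.single 1 1)
  have e2 := h1 (Pi.single 2 1)
  simp [det3] at e0 e1 e2
  -- a nonzero coordinate of `p i` gives a linear relation between `p i` and `p j`
  have hli := LinearIndependent.pair_iff.1 (hp.pair i j hij)
  have hrel : ∀ m n : Fin 3, p j m * p i n = p i m * p j n := by
    intro m n
    fin_cases m <;> fin_cases n <;> dsimp <;>
      first
      | exact mul_comm _ _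
      | linear_combination e0
      | linear_combination -e0
      | linear_combination e1
      | linear_combination -e1
      | linear_combination e2
      | linear_combination -e2
  have key : ∀ m : Fin 3, p i m = 0 := by
    intro m
    have h2 := hli (p j m) (-p i m) (by
      ext n
      simp only [Pi.add_apply, Pi.smul_apply, smul_eq_mul, Pi.zero_apply]
      linear_combination hrel m n)
    simpa using h2.2
  have h3 := hli 1 0 (by ext m; simp [key m])
  exact one_ne_zero h3.1

theorem two_ne_zero_of_odd_card [Finite F] (hq : Odd (Nat.card F)) : (2 : F) ≠ 0 := by
  have := Fintype.ofFinite F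
  rw [Nat.card_eq_fintype_card] at hq
  refine Ring.two_ne_zero fun h => ?_
  have := FiniteField.even_card_of_char_two h
  rw [Nat.odd_iff] at hq
  omega

/-- In the coordinates on the pencil of lines through `p i` given by the two tangent forms, the
determinant with first column `p i` is, up to a constant, the determinant of size two. -/
theorem exists_mul_det3_eq (h2 : (2 : F) ≠ 0) {i : ι} {a b : Module.Dual F (Fin 3 → F)}
    (ha : ∀ j, j ≠ i → a (p j) ≠ 0)
    (hker : ∀ x, a x = 0 → b x = 0 → x ∈ Submodule.span F {p i})
    (hsurj : ∀ c : F, c ≠ 0 → ∃ j, j ≠ i ∧ b (p j) = c * a (p j)) :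
    ∃ k : F, k ≠ 0 ∧ ∀ x y, k * det3 (p i) x y = a x * b y - a y * b x := by
  -- the cross product of the coefficient vectors of `a` and `b` is killed by both forms
  have ha' := dual_apply a
  have hb' := dual_apply b
  generalize a (Pi.single 0 1) = a0 at ha'
  generalize a (Pi.single 1 1) = a1 at ha'
  generalize a (Pi.single 2 1) = a2 at ha'
  generalize b (Pi.single 0 1) = b0 at hb'
  generalize b (Pi.single 1 1) = b1 at hb'
  generalize b (Pi.single 2 1) = b2 at hb'
  obtain ⟨k, hk⟩ := Submodule.mem_span_singleton.1
    (hker ![a1 * b2 - a2 * b1, a2 * b0 - a0 * b2, a0 * b1 - a1 * b0]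
      (by rw [ha']; simp; ring) (by rw [hb']; simp; ring))
  have k0 : k * p i 0 = a1 * b2 - a2 * b1 := by simpa using congrFun hk 0
  have k1 : k * p i 1 = a2 * b0 - a0 * b2 := by simpa using congrFun hk 1
  have k2 : k * p i 2 = a0 * b1 - a1 * b0 := by simpa using congrFun hk 2
  have hform : ∀ x y, k * det3 (p i) x y = a x * b y - a y * b x := by
    intro x y
    rw [ha', hb', ha', hb']
    simp only [det3]
    linear_combination (x 1 * y 2 - x 2 * y 1) * k0 + (x 2 * y 0 - x 0 * y 2) * k1 +
      (x 0 * y 1 - x 1 * y 0) * k2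
  refine ⟨k, ?_, hform⟩
  rintro rfl
  obtain ⟨j, hj, hjb⟩ := hsurj 1 one_ne_zero
  obtain ⟨l, hl, hlb⟩ := hsurj (-1) (neg_ne_zero.2 one_ne_zero)
  have h := hform (p j) (p l)
  rw [hjb, hlb] at h
  exact mul_ne_zero h2 (mul_ne_zero (ha j hj) (ha l hl)) (by linear_combination h)

/-- The product of the two tangent forms at `p i`, evaluated at another point `p j` of the arc, is
up to a constant the inverse of the product of the secant forms at `p i`. In terms of the slopes
`b / a` this holds because the product of the differences of a slope with all other slopes,
including that of the tangent `b = 0`, is the product of all nonzero elements of `F`. -/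
theorem exists_mul_prod_eq [Finite F] [Fintype ι] [DecidableEq ι] (hι : Nat.card ι = Nat.card F)
    {i : ι} {a b : Module.Dual F (Fin 3 → F)}
    (ha : ∀ j, j ≠ i → a (p j) ≠ 0) (hb : ∀ j, j ≠ i → b (p j) ≠ 0)
    (hsurj : ∀ c : F, c ≠ 0 → ∃ j, j ≠ i ∧ b (p j) = c * a (p j))
    {k : F} (hk : k ≠ 0) (hdet : ∀ x y, k * det3 (p i) x y = a x * b y - a y * b x) :
    ∃ C : F, C ≠ 0 ∧ ∀ j, j ≠ i → a (p j) * b (p j) *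
      ∏ w ∈ (Finset.univ.erase i).erase j, det3 (p i) (p w) (p j) = C := by
  classical
  have := Fintype.ofFinite F
  simp only [Nat.card_eq_fintype_card] at hι
  let τ : ι → F := fun w => b (p w) / a (p w)
  have hτ0 : ∀ w, w ≠ i → τ w ≠ 0 := fun w hw => div_ne_zero (hb w hw) (ha w hw)
  have hcard : ((Finset.univ : Finset ι).erase i).card =
      ((Finset.univ : Finset F).erase 0).card := by
    rw [Finset.card_erase_of_mem (Finset.mem_univ _), Finset.card_erase_of_mem (Finset.mem_univ _),
      Finset.card_univ, Finset.card_univ, hι]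
  have hτsurj : Set.SurjOn τ ((Finset.univ : Finset ι).erase i)
      ((Finset.univ : Finset F).erase 0) := by
    intro c hc
    obtain ⟨j, hj, hjc⟩ := hsurj c (by simpa using hc)
    exact ⟨j, by simpa using hj, by simp [τ, hjc, ha j hj]⟩
  have hτinj : Set.InjOn τ ((Finset.univ : Finset ι).erase i) :=
    Finset.injOn_of_surjOn_of_card_le τ (fun w hw => by simpa using hτ0 w (by simpa using hw))
      hτsurj hcard.le
  have hprod : ∀ j, j ≠ i → τ j * ∏ w ∈ (Finset.univ.erase i).erase j, (τ j - τ w) =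
      ∏ σ ∈ (Finset.univ : Finset F).erase 0, σ := by
    intro j hj
    rw [← Finset.mul_prod_erase ((Finset.univ : Finset F).erase 0) (fun σ => σ)
      (a := τ j) (by simpa using hτ0 j hj)]
    congr 1
    refine Finset.prod_nbij (fun w => τ j - τ w) ?_ ?_ ?_ (fun _ _ => rfl)
    · intro w hw
      simp only [Finset.mem_erase, Finset.mem_univ, and_true] at hw ⊢
      refine ⟨fun h => hτ0 w hw.2 (by simpa using h), fun h => hw.1 ?_⟩
      exact (hτinj (by simpa using hj) (by simpa using hw.2) (sub_eq_zero.1 h)).symm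
    · intro w hw w' hw' h
      simp only [Finset.coe_erase, Finset.coe_univ, Set.mem_sdiff, Set.mem_univ, true_and,
        Set.mem_singleton_iff] at hw hw'
      exact hτinj (by simpa using hw.1) (by simpa using hw'.1) (sub_right_injective h)
    · intro σ hσ
      simp only [Finset.coe_erase, Finset.coe_univ, Set.mem_sdiff, Set.mem_univ, true_and,
        Set.mem_singleton_iff] at hσ
      obtain ⟨w, hw, hwσ⟩ := hτsurj (show τ j - σ ∈ _ by
        simpa [sub_eq_zero] using Ne.symm hσ.2)
      refine ⟨w, ?_, by simp only [hwσ]; ring⟩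
      simp only [Finset.coe_erase, Finset.coe_univ, Set.mem_sdiff, Set.mem_univ, true_and,
        Set.mem_singleton_iff] at hw ⊢
      refine ⟨hw, ?_⟩
      rintro rfl
      exact hσ.1 (by linear_combination hwσ)
  have hq : 2 ≤ Fintype.card F := Fintype.one_lt_card
  let A := ∏ w ∈ Finset.univ.erase i, a (p w)
  let W := ∏ σ ∈ (Finset.univ : Finset F).erase 0, σ
  have hA : A ≠ 0 := Finset.prod_ne_zero_iff.2 fun w hw => ha w (by simpa using hw)
  have hW : W ≠ 0 := Finset.prod_ne_zero_iff.2 fun σ hσ => by simpa using hσ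
  have hkq : k ^ (Fintype.card F - 2) ≠ 0 := pow_ne_zero _ hk
  refine ⟨A * W / k ^ (Fintype.card F - 2), div_ne_zero (mul_ne_zero hA hW) hkq,
    fun j hj => ?_⟩
  have hjmem : j ∈ (Finset.univ : Finset ι).erase i := by simpa using hj
  have hcard' : ((Finset.univ.erase i).erase j : Finset ι).card = Fintype.card F - 2 := by
    rw [Finset.card_erase_of_mem hjmem, Finset.card_erase_of_mem (Finset.mem_univ _),
      Finset.card_univ, hι]
    omega
  rw [eq_div_iff hkq]
  have h1 : (∏ w ∈ (Finset.univ.erase i).erase j, det3 (p i) (p w) (p j)) *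
      k ^ (Fintype.card F - 2) =
      ∏ w ∈ (Finset.univ.erase i).erase j, (a (p j) * (a (p w) * (τ j - τ w))) := by
    rw [← hcard', ← Finset.prod_const, ← Finset.prod_mul_distrib]
    refine Finset.prod_congr rfl fun w hw => ?_
    simp only [Finset.mem_erase, Finset.mem_univ, and_true] at hw
    rw [mul_comm, hdet]
    have := ha j hj
    have := ha w hw.2
    simp only [τ]
    field_simp
  rw [mul_assoc, h1, Finset.prod_mul_distrib, Finset.prod_mul_distrib, Finset.prod_const, hcard']
  have h2 : a (p j) * ∏ w ∈ (Finset.univ.erase i).erase j, a (p w) = A :=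
    Finset.mul_prod_erase _ (fun w => a (p w)) hjmem
  have h3 := hprod j hj
  have h4 : b (p j) = a (p j) * τ j := (mul_div_cancel₀ _ (ha j hj)).symm
  have h5 : a (p j) * a (p j) ^ (Fintype.card F - 2) = 1 := by
    rw [← pow_succ', show Fintype.card F - 2 + 1 = Fintype.card F - 1 by omega]
    exact FiniteField.pow_card_sub_one_eq_one _ (ha j hj)
  rw [← h2, h4]
  simp only [W]
  rw [← h3]
  linear_combination (a (p j) * (∏ w ∈ (Finset.univ.erase i).erase j, a (p w)) * τ j *
    ∏ w ∈ (Finset.univ.erase i).erase j, (τ j - τ w)) * h5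

/-- Segre's lemma of tangents: suitably scaled, the products `a i * b i` of the two tangent forms at
the points of a `q`-arc, `q` odd, are antisymmetric on pairs of points of the arc. -/
theorem exists_antisymm_tangent_forms [Finite F] (hq : Odd (Nat.card F))
    (hp : ArcFamily (F := F) p) (hι : Nat.card ι = Nat.card F) :
    ∃ a b : ι → Module.Dual F (Fin 3 → F), (∀ i, a i (p i) = 0 ∧ b i (p i) = 0) ∧
      (∀ i j, j ≠ i → a i (p j) ≠ 0 ∧ b i (p j) ≠ 0) ∧
      (∀ i, ∃ k : F, k ≠ 0 ∧ ∀ x y, k * det3 (p i) x y = a i x * b i y - a i y * b i x) ∧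
      (∀ i, ∀ c : F, c ≠ 0 → ∃ j, j ≠ i ∧ b i (p j) = c * a i (p j)) ∧
      ∀ i j, a i (p j) * b i (p j) = -(a j (p i) * b j (p i)) := by
  classical
  have : Finite ι := Nat.finite_of_card_ne_zero (hι ▸ Nat.card_pos.ne')
  have := Fintype.ofFinite ι
  have h2 := two_ne_zero_of_odd_card hq
  choose a b ha0 hb0 hab hker hsurj using
    exists_tangent_forms (by simp) hp hι
  choose k hk hdet using fun i => exists_mul_det3_eq h2 (fun j hj => (hab i j hj).1) (hker i)
    (hsurj i)
  choose C hC hprod using fun i => exists_mul_prod_eq hι (fun j hj => (hab i j hj).1)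
    (fun j hj => (hab i j hj).2) (hsurj i) (hk i) (hdet i)
  refine ⟨fun i => (C i)⁻¹ • a i, b, fun i => ⟨by simp [ha0], hb0 i⟩,
    fun i j hj => ⟨by simp [(hab i j hj).1, hC i], (hab i j hj).2⟩,
    fun i => ⟨(C i)⁻¹ * k i, mul_ne_zero (inv_ne_zero (hC i)) (hk i), fun x y => ?_⟩,
    fun i c hc => ?_, fun i j => ?_⟩
  · simp only [LinearMap.smul_apply, smul_eq_mul]
    linear_combination (C i)⁻¹ * hdet i x y
  · have hcC : c * (C i)⁻¹ ≠ 0 := mul_ne_zero hc (inv_ne_zero (hC i))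
    obtain ⟨j, hj, h⟩ := hsurj i (c * (C i)⁻¹) hcC
    exact ⟨j, hj, by rw [h, LinearMap.smul_apply, smul_eq_mul, mul_assoc]⟩
  · by_cases hij : i = j
    · subst hij; simp [ha0]
    have hcardF : 1 < Nat.card F := Finite.one_lt_card
    have hswap : ∏ w ∈ (Finset.univ.erase j).erase i, det3 (p j) (p w) (p i) =
        -∏ w ∈ (Finset.univ.erase i).erase j, det3 (p i) (p w) (p j) := by
      have hodd : Odd ((Finset.univ.erase i).erase j : Finset ι).card := by
        rw [Finset.card_erase_of_mem (by simpa using Ne.symm hij),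
          Finset.card_erase_of_mem (Finset.mem_univ _), Finset.card_univ,
          ← Nat.card_eq_fintype_card, hι]
        rw [Nat.odd_iff] at hq ⊢
        omega
      rw [Finset.erase_right_comm]
      simp only [fun w => det3_reverse (p i) (p w) (p j)]
      rw [Finset.prod_neg, hodd.neg_one_pow, neg_one_mul]
    have hne : ∏ w ∈ (Finset.univ.erase i).erase j, det3 (p i) (p w) (p j) ≠ 0 :=
      Finset.prod_ne_zero_iff.2 fun w hw => by
        simp only [Finset.mem_erase, Finset.mem_univ, and_true] at hw
        exact hp.det3_ne_zero hw.2.symm hij hw.1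
    have e1 := hprod i j (Ne.symm hij)
    have e2 := hprod j i hij
    rw [hswap] at e2
    have := hC i
    have := hC j
    simp only [LinearMap.smul_apply, smul_eq_mul]
    apply mul_right_cancel₀ hne
    have e1' : (C i)⁻¹ * (a i (p j) * b i (p j) *
        ∏ w ∈ (Finset.univ.erase i).erase j, det3 (p i) (p w) (p j)) = 1 := by
      rw [e1, inv_mul_cancel₀ (hC i)]
    have e2' : (C j)⁻¹ * (a j (p i) * b j (p i) *
        -∏ w ∈ (Finset.univ.erase i).erase j, det3 (p i) (p w) (p j)) = 1 := by
      rw [e2, inv_mul_cancel₀ (hC j)]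
    linear_combination e1' - e2'

end Segre

/-! ### Arcs, cubics and conics -/

section Conic

open Matrix

variable {F : Type u} [Field F]

/-- If the vectors `v i` span, functionals `c i` with `c i (v j)` antisymmetric in `i` and `j` come
from a single antisymmetric bilinear form. -/
theorem exists_antisymm_matrix {ι n : Type*} [Fintype n] [DecidableEq n] {v c : ι → n → F}
    (hv : Submodule.span F (Set.range v) = ⊤) (hc : ∀ i j, c i ⬝ᵥ v j = -(c j ⬝ᵥ v i)) :
    ∃ M : Matrix n n F, (∀ i, c i = M *ᵥ v i) ∧ ∀ k l, M k l = -M l k := by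
  have h1 : ∀ w : n → F, ∃ d : n → F, ∀ i, c i ⬝ᵥ w = d ⬝ᵥ v i := by
    intro w
    have hw : w ∈ Submodule.span F (Set.range v) := hv ▸ Submodule.mem_top
    induction hw using Submodule.span_induction with
    | mem x hx =>
      obtain ⟨j, rfl⟩ := hx
      exact ⟨-c j, fun i => by rw [hc, neg_dotProduct]⟩
    | zero => exact ⟨0, fun i => by simp⟩
    | add x y _ _ hx hy =>
      obtain ⟨d, hd⟩ := hx
      obtain ⟨e, he⟩ := hy
      exact ⟨d + e, fun i => by rw [dotProduct_add, hd, he, add_dotProduct]⟩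
    | smul r x _ hx =>
      obtain ⟨d, hd⟩ := hx
      exact ⟨r • d, fun i => by rw [dotProduct_smul, hd, smul_dotProduct]⟩
  choose d hd using fun k : n => h1 (Pi.single k 1)
  let M : Matrix n n F := Matrix.of d
  have hM : ∀ i, c i = M *ᵥ v i := by
    intro i
    ext k
    have := hd k i
    rw [dotProduct_single_one] at this
    exact this
  have hext : ∀ L : Module.Dual F (n → F), (∀ i, L (v i) = 0) → L = 0 := by
    intro L hL
    exact LinearMap.ext_on_range hv hL
  refine ⟨M, hM, fun k l => ?_⟩
  have h2 : ∀ i w, (M *ᵥ v i) ⬝ᵥ w = -((M *ᵥ w) ⬝ᵥ v i) := by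
    intro i w
    have hL := hext
      { toFun := fun w => (M *ᵥ v i) ⬝ᵥ w + (M *ᵥ w) ⬝ᵥ v i
        map_add' := fun x y => by
          simp only [dotProduct_add, mulVec_add, add_dotProduct]; ring
        map_smul' := fun r x => by
          simp only [dotProduct_smul, mulVec_smul, smul_dotProduct, smul_eq_mul,
            RingHom.id_apply]
          ring }
      (fun j => by
        simp only [LinearMap.coe_mk, AddHom.coe_mk, ← hM]
        rw [hc i j]; ring)
    exact eq_neg_of_add_eq_zero_left (LinearMap.congr_fun hL w)
  have h3 : ∀ u w, (M *ᵥ u) ⬝ᵥ w = -((M *ᵥ w) ⬝ᵥ u) := by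
    intro u w
    have hL := hext
      { toFun := fun u => (M *ᵥ u) ⬝ᵥ w + (M *ᵥ w) ⬝ᵥ u
        map_add' := fun x y => by
          simp only [dotProduct_add, mulVec_add, add_dotProduct]; ring
        map_smul' := fun r x => by
          simp only [dotProduct_smul, mulVec_smul, smul_dotProduct, smul_eq_mul,
            RingHom.id_apply]
          ring }
      (fun j => by
        simp only [LinearMap.coe_mk, AddHom.coe_mk]
        rw [h2]; ring)
    exact eq_neg_of_add_eq_zero_left (LinearMap.congr_fun hL u)
  have := h3 (Pi.single l 1) (Pi.single k 1)
  simpa using this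

/-- The Veronese map: the values of the six quadratic monomials. -/
def veronese (x : Fin 3 → F) : Fin 6 → F :=
  ![x 0 * x 0, x 1 * x 1, x 2 * x 2, x 1 * x 2, x 2 * x 0, x 0 * x 1]

/-- If the arc, containing the three base points, does not lie on a conic, then it lies on a
certain cubic. Off the conics, the forms `a i * b i` are the values at `p i` of an alternating form
on the quadratic monomials. The cubic expresses that `a i * b i`, having a double point at `p i`, is
invariant under translation by `p i`. -/
theorem exists_cubic (h2 : (2 : F) ≠ 0) {ι : Type*} {p : ι → Fin 3 → F}
    {a b : ι → Module.Dual F (Fin 3 → F)} (hab : ∀ i, a i (p i) = 0 ∧ b i (p i) = 0)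
    (hanti : ∀ i j, a i (p j) * b i (p j) = -(a j (p i) * b j (p i))) {i₀ i₁ i₂ : ι}
    (h0 : p i₀ = Pi.single 0 1) (h1 : p i₁ = Pi.single 1 1) (h2' : p i₂ = Pi.single 2 1)
    (hspan : Submodule.span F (Set.range fun i => veronese (p i)) = ⊤) :
    ∃ β γ : F, ∀ i, p i 0 * (a i₀ (p i) * b i₀ (p i)) =
      p i 1 * p i 2 * (β * p i 1 + γ * p i 2) := by
  let A : ι → Fin 3 → F := fun i k => a i (Pi.single k 1)
  let B : ι → Fin 3 → F := fun i k => b i (Pi.single k 1)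
  have hA : ∀ i x, a i x = A i 0 * x 0 + A i 1 * x 1 + A i 2 * x 2 := fun i => dual_apply (a i)
  have hB : ∀ i x, b i x = B i 0 * x 0 + B i 1 * x 1 + B i 2 * x 2 := fun i => dual_apply (b i)
  let c : ι → Fin 6 → F := fun i => ![A i 0 * B i 0, A i 1 * B i 1, A i 2 * B i 2,
    A i 1 * B i 2 + A i 2 * B i 1, A i 2 * B i 0 + A i 0 * B i 2, A i 0 * B i 1 + A i 1 * B i 0]
  have hc : ∀ i x, c i ⬝ᵥ veronese x = a i x * b i x := by
    intro i x
    rw [hA, hB]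
    simp [c, veronese, dotProduct, Fin.sum_univ_succ]
    ring
  obtain ⟨M, hM, hMa⟩ := exists_antisymm_matrix (v := fun i => veronese (p i)) (c := c) hspan
    (fun i j => by rw [hc, hc]; exact hanti i j)
  have hMc : ∀ i k, c i k = M k 0 * (p i 0 * p i 0) + M k 1 * (p i 1 * p i 1) +
      M k 2 * (p i 2 * p i 2) + M k 3 * (p i 1 * p i 2) + M k 4 * (p i 2 * p i 0) +
      M k 5 * (p i 0 * p i 1) := by
    intro i k
    rw [hM]
    simp [mulVec, dotProduct, veronese, Fin.sum_univ_succ]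
    ring
  have hdiag : ∀ k, M k k = 0 := fun k => by
    have := hMa k k
    exact (mul_eq_zero.1 (show 2 * M k k = 0 by linear_combination this)).resolve_left h2
  -- the columns of `M` at the squares are the coefficient vectors at the base points
  have col0 : ∀ k, M k 0 = c i₀ k := fun k => by rw [hMc, h0]; simp
  have col1 : ∀ k, M k 1 = c i₁ k := fun k => by rw [hMc, h1]; simp
  have col2 : ∀ k, M k 2 = c i₂ k := fun k => by rw [hMc, h2']; simp
  have a0 : A i₀ 0 = 0 := by simpa [A, h0] using (hab i₀).1
  have b0 : B i₀ 0 = 0 := by simpa [B, h0] using (hab i₀).2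
  have a1 : A i₁ 1 = 0 := by simpa [A, h1] using (hab i₁).1
  have b1 : B i₁ 1 = 0 := by simpa [B, h1] using (hab i₁).2
  have a2 : A i₂ 2 = 0 := by simpa [A, h2'] using (hab i₂).1
  have b2 : B i₂ 2 = 0 := by simpa [B, h2'] using (hab i₂).2
  have m40 : M 4 0 = 0 := by rw [col0]; simp [c, a0, b0]
  have m50 : M 5 0 = 0 := by rw [col0]; simp [c, a0, b0]
  have m51 : M 5 1 = 0 := by rw [col1]; simp [c, a1, b1]
  have m42 : M 4 2 = 0 := by rw [col2]; simp [c, a2, b2]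
  have m01 : M 0 1 = -(A i₀ 1 * B i₀ 1) := by rw [hMa, col0]; simp [c]
  have m02 : M 0 2 = -(A i₀ 2 * B i₀ 2) := by rw [hMa, col0]; simp [c]
  have m03 : M 0 3 = -(A i₀ 1 * B i₀ 2 + A i₀ 2 * B i₀ 1) := by rw [hMa, col0]; simp [c]
  have m04 : M 0 4 = 0 := by rw [hMa, m40, neg_zero]
  have m05 : M 0 5 = 0 := by rw [hMa, m50, neg_zero]
  refine ⟨(M 5 3 + M 4 1) / 2, (M 5 2 + M 4 3) / 2, fun i => ?_⟩
  have hpolar : 2 * c i 0 * p i 0 + c i 5 * p i 1 + c i 4 * p i 2 = 0 := by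
    have e1 := (hab i).1
    have e2 := (hab i).2
    rw [hA] at e1
    rw [hB] at e2
    simp [c]
    linear_combination A i 0 * e2 + B i 0 * e1
  rw [hMc, hMc, hMc, hdiag 0, m01, m02, m03, m04, m05, m50, m51, hdiag 5, m40, m42, hdiag 4,
    hMa 5 4] at hpolar
  rw [hA, hB, a0, b0]
  field_simp
  linear_combination -hpolar

/-- The affine shape of the cubic above: `X y` is the first coordinate of the point of the arc at
height `y`. If the right-hand side had root `0` or none, then `X` would be invariant under the
involution of the line exchanging the two tangents `t₁` and `t₂` and fixing `0` respectively
exchanging `0` and infinity; but `X` is injective. -/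
theorem eq_root_of_injOn [Finite F] (hF : 5 < Nat.card F) (h20 : (2 : F) ≠ 0)
    {t₁ t₂ s β γ : F} (h1 : t₁ ≠ 0)
    (h2 : t₂ ≠ 0) (hs : s ≠ 0) {X : F → F}
    (hX0 : ∀ y, y ≠ 0 → y ≠ t₁ → y ≠ t₂ → X y ≠ 0)
    (hinj : ∀ y y', y ≠ 0 → y ≠ t₁ → y ≠ t₂ → y' ≠ 0 → y' ≠ t₁ → y' ≠ t₂ → X y = X y' → y = y')
    (heq : ∀ y, y ≠ 0 → y ≠ t₁ → y ≠ t₂ →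
      X y * (s * ((y - t₁) * (y - t₂))) = y * (β * y + γ)) :
    β ≠ 0 ∧ (γ = -(β * t₁) ∨ γ = -(β * t₂)) := by
  classical
  have := Fintype.ofFinite F
  rw [Nat.card_eq_fintype_card] at hF
  have havoid : ∀ c d : F, ∃ y : F, y ≠ 0 ∧ y ≠ t₁ ∧ y ≠ t₂ ∧ y ≠ c ∧ y ≠ d := by
    intro c d
    by_contra! h
    have hsub : (Finset.univ : Finset F) ⊆ {0, t₁, t₂, c, d} := by
      intro y _
      have := h y
      simp only [Finset.mem_insert, Finset.mem_singleton]
      tauto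
    have := (Finset.card_le_card hsub).trans Finset.card_le_five
    rw [Finset.card_univ] at this
    omega
  have hcancel : ∀ y, y ≠ t₁ → y ≠ t₂ → s * ((y - t₁) * (y - t₂)) ≠ 0 := fun y hy1 hy2 =>
    mul_ne_zero hs (mul_ne_zero (sub_ne_zero.2 hy1) (sub_ne_zero.2 hy2))
  have hβ : β ≠ 0 := by
    rintro rfl
    -- `X` is invariant under `y ↦ t₁ * t₂ / y`
    have hsq : ∀ y, y ≠ 0 → y ≠ t₁ → y ≠ t₂ → y * y = t₁ * t₂ := by
      intro y hy hy1 hy2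
      have hy' : t₁ * t₂ / y ≠ 0 := div_ne_zero (mul_ne_zero h1 h2) hy
      have hy1' : t₁ * t₂ / y ≠ t₁ := by
        intro h
        rw [div_eq_iff hy] at h
        exact hy2 (mul_left_cancel₀ h1 h).symm
      have hy2' : t₁ * t₂ / y ≠ t₂ := by
        intro h
        rw [div_eq_iff hy, mul_comm] at h
        exact hy1 (mul_left_cancel₀ h2 h).symm
      have e1 := heq y hy hy1 hy2
      have e2 := heq _ hy' hy1' hy2'
      have hXX : X y = X (t₁ * t₂ / y) := by
        apply mul_right_cancel₀ (hcancel y hy1 hy2)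
        rw [e1]
        field_simp at e2
        linear_combination -e2
      have := hinj _ _ hy hy1 hy2 hy' hy1' hy2' hXX
      rwa [eq_div_iff hy] at this
    obtain ⟨y, hy, hy1, hy2, -, -⟩ := havoid 0 0
    obtain ⟨z, hz, hz1, hz2, hzy, hzy'⟩ := havoid y (-y)
    have e : z * z = y * y := (hsq z hz hz1 hz2).trans (hsq y hy hy1 hy2).symm
    rcases mul_self_eq_mul_self_iff.1 e with h | h
    · exact hzy h
    · exact hzy' h
  refine ⟨hβ, ?_⟩
  by_cases hγ : γ = 0
  · exfalso
    subst hγ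
    -- `X` is invariant under the involution `1 / y ↦ 1 / t₁ + 1 / t₂ - 1 / y`
    obtain ⟨y, hy, hy1, hy2, hy3, hy4⟩ := havoid (t₁ * t₂ / (t₁ + t₂)) (2 * (t₁ * t₂) / (t₁ + t₂))
    have hd : y * (t₁ + t₂) - t₁ * t₂ ≠ 0 := by
      intro h
      by_cases ht : t₁ + t₂ = 0
      · rw [ht] at h
        exact mul_ne_zero h1 h2 (by linear_combination -h)
      · exact hy3 (by rw [eq_div_iff ht]; linear_combination h)
    obtain ⟨d, hdd⟩ : ∃ d, d = y * (t₁ + t₂) - t₁ * t₂ := ⟨_, rfl⟩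
    rw [← hdd] at hd
    have hz : y * (t₁ * t₂) / d ≠ 0 := div_ne_zero (mul_ne_zero hy (mul_ne_zero h1 h2)) hd
    have hz1 : y * (t₁ * t₂) / d ≠ t₁ := by
      intro h
      rw [div_eq_iff hd, hdd] at h
      exact hy2 (mul_left_cancel₀ (mul_ne_zero h1 h1) (by linear_combination -h))
    have hz2 : y * (t₁ * t₂) / d ≠ t₂ := by
      intro h
      rw [div_eq_iff hd, hdd] at h
      exact hy1 (mul_left_cancel₀ (mul_ne_zero h2 h2) (by linear_combination -h))
    have e1 := heq y hy hy1 hy2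
    have e2 := heq _ hz hz1 hz2
    have f1 : y * (t₁ * t₂) / d - t₁ = t₁ * t₁ * (t₂ - y) / d := by
      rw [div_sub' hd, hdd]; ring
    have f2 : y * (t₁ * t₂) / d - t₂ = t₂ * t₂ * (t₁ - y) / d := by
      rw [div_sub' hd, hdd]; ring
    rw [f1, f2] at e2
    have hXX : X y = X (y * (t₁ * t₂) / d) := by
      apply mul_right_cancel₀ (hcancel y hy1 hy2)
      rw [e1]
      generalize X (y * (t₁ * t₂) / d) = ξ at e2 ⊢
      field_simp at e2
      apply mul_left_cancel₀ (mul_ne_zero h1 h2)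
      linear_combination -e2
    have := hinj _ _ hy hy1 hy2 hz hz1 hz2 hXX
    rw [eq_div_iff hd, hdd] at this
    have h3 : y * (t₁ + t₂) = 2 * (t₁ * t₂) := by
      apply mul_left_cancel₀ hy
      linear_combination this
    by_cases ht : t₁ + t₂ = 0
    · rw [ht, mul_zero] at h3
      exact mul_ne_zero h20 (mul_ne_zero h1 h2) h3.symm
    · exact hy4 (by rw [eq_div_iff ht]; exact h3)
  · by_contra! h
    have hr1 : -γ / β ≠ t₁ := by
      intro e
      rw [div_eq_iff hβ] at e
      exact h.1 (by linear_combination -e)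
    have hr2 : -γ / β ≠ t₂ := by
      intro e
      rw [div_eq_iff hβ] at e
      exact h.2 (by linear_combination -e)
    have hr0 : -γ / β ≠ 0 := div_ne_zero (neg_ne_zero.2 hγ) hβ
    have e := heq _ hr0 hr1 hr2
    rw [show β * (-γ / β) + γ = 0 by field_simp; ring, mul_zero] at e
    exact mul_ne_zero (hX0 _ hr0 hr1 hr2) (hcancel _ hr1 hr2) e

end Conic

/-! ### For odd `q` a `q`-arc lies on a conic -/

section Segre

open Matrix

variable {F : Type u} [Field F] [Finite F] {ι : Type*} {p : ι → Fin 3 → F}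

/-- An arc that lies on the cubic of `exists_cubic` lies on a conic: the cubic splits off the
tangent `a = 0` or `b = 0` at the first base point. -/
theorem exists_conic_of_cubic (hF : 5 < Nat.card F) (h20 : (2 : F) ≠ 0)
    (hp : ArcFamily (F := F) p) {i₀ i₁ i₂ : ι}
    (h0 : p i₀ = Pi.single 0 1) (h1 : p i₁ = Pi.single 1 1) (h2 : p i₂ = Pi.single 2 1)
    {a b : Module.Dual F (Fin 3 → F)} (ha0 : a (p i₀) = 0) (hb0 : b (p i₀) = 0)
    (hab : ∀ j, j ≠ i₀ → a (p j) ≠ 0 ∧ b (p j) ≠ 0)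
    {k : F} (hk : k ≠ 0) (hdet : ∀ x y, k * det3 (p i₀) x y = a x * b y - a y * b x)
    (hsurj : ∀ c : F, c ≠ 0 → ∃ j, j ≠ i₀ ∧ b (p j) = c * a (p j)) {β γ : F}
    (hcubic : ∀ i, p i 0 * (a (p i) * b (p i)) = p i 1 * p i 2 * (β * p i 1 + γ * p i 2)) :
    ∃ A B C : F, A ≠ 0 ∧ B ≠ 0 ∧ C ≠ 0 ∧
      ∀ i, A * (p i 1 * p i 2) + B * (p i 2 * p i 0) + C * (p i 0 * p i 1) = 0 := by
  have ha := dual_apply a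
  have hb := dual_apply b
  rw [h0] at ha0 hb0
  rw [ha0] at ha
  rw [hb0] at hb
  have h01 : i₁ ≠ i₀ := fun h => by
    rw [h, h0] at h1; simpa using congrFun h1 0
  have h02 : i₂ ≠ i₀ := fun h => by
    rw [h, h0] at h2; simpa using congrFun h2 0
  have hab1 := hab i₁ h01
  have hab2 := hab i₂ h02
  rw [h1] at hab1
  rw [h2] at hab2
  generalize a (Pi.single 1 1) = a1 at *
  generalize a (Pi.single 2 1) = a2 at *
  generalize b (Pi.single 1 1) = b1 at *
  generalize b (Pi.single 2 1) = b2 at *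
  obtain ⟨ha1, hb1⟩ := hab1
  obtain ⟨ha2, hb2⟩ := hab2
  -- the tangents at the first base point are `x 1 = t₁ * x 2` and `x 1 = t₂ * x 2`
  obtain ⟨t₁, ht₁⟩ : ∃ t, a1 * t = -a2 := ⟨-a2 / a1, mul_div_cancel₀ _ ha1⟩
  obtain ⟨t₂, ht₂⟩ : ∃ t, b1 * t = -b2 := ⟨-b2 / b1, mul_div_cancel₀ _ hb1⟩
  have ht₁0 : t₁ ≠ 0 := by rintro rfl; exact ha2 (by linear_combination ht₁)
  have ht₂0 : t₂ ≠ 0 := by rintro rfl; exact hb2 (by linear_combination ht₂)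
  have hdet0 : ∀ x y, det3 (p i₀) x y = x 1 * y 2 - x 2 * y 1 := fun x y => by
    rw [h0]; simp [det3]
  -- every other line through the first base point contains a second point of the arc
  have hex : ∀ y : F, ∃ i, y ≠ 0 → y ≠ t₁ → y ≠ t₂ → p i 2 ≠ 0 ∧ p i 1 = y * p i 2 := by
    intro y
    by_cases hy : y ≠ t₁ ∧ y ≠ t₂
    swap
    · exact ⟨i₀, fun _ h1 h2 => absurd ⟨h1, h2⟩ hy⟩
    have hya : a1 * y + a2 ≠ 0 := fun h =>
      hy.1 (mul_left_cancel₀ ha1 (by linear_combination h - ht₁))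
    have hyb : b1 * y + b2 ≠ 0 := fun h =>
      hy.2 (mul_left_cancel₀ hb1 (by linear_combination h - ht₂))
    obtain ⟨j, hj, hjc⟩ := hsurj ((b1 * y + b2) / (a1 * y + a2)) (div_ne_zero hyb hya)
    refine ⟨j, fun hy0 _ _ => ?_⟩
    have hay : a ![0, y, 1] = a1 * y + a2 := by rw [ha]; simp
    have hby : b ![0, y, 1] = b1 * y + b2 := by rw [hb]; simp
    have e := hdet (p j) ![0, y, 1]
    rw [hjc, hay, hby, hdet0] at e
    have e' : k * (p j 1 - p j 2 * y) = 0 := by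
      have e3 : (a1 * y + a2) * ((b1 * y + b2) / (a1 * y + a2)) = b1 * y + b2 :=
        mul_div_cancel₀ _ hya
      simp only [cons_val_one, cons_val_zero, cons_val] at e
      linear_combination e - a (p j) * e3
    have e2 : p j 1 = y * p j 2 := by
      linear_combination (mul_eq_zero.1 e').resolve_left hk
    refine ⟨fun hz => (hab j hj).1 ?_, e2⟩
    rw [ha, e2, hz]; ring
  choose σ hσ using hex
  have hroot := eq_root_of_injOn (X := fun y => p (σ y) 0 / p (σ y) 2) hF h20 ht₁0 ht₂0
    (mul_ne_zero ha1 hb1) (β := β) (γ := γ) ?_ ?_ ?_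
  rotate_left
  · intro y hy hy1 hy2
    obtain ⟨e1, e2⟩ := hσ y hy hy1 hy2
    refine div_ne_zero (fun h => ?_) e1
    have n1 : σ y ≠ i₁ := fun h => e1 (by rw [h, h1]; simp)
    have n2 : σ y ≠ i₂ := fun h => mul_ne_zero hy e1 (by rw [← e2, h, h2]; simp)
    have n12 : i₁ ≠ i₂ := fun h => by rw [h, h2] at h1; simpa using congrFun h1 1
    refine hp.det3_ne_zero n12 n1.symm n2.symm ?_
    rw [h1, h2]
    simp [det3, h]
  · intro y y' hy hy1 hy2 hy' hy1' hy2' h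
    obtain ⟨e1, e2⟩ := hσ y hy hy1 hy2
    obtain ⟨e1', e2'⟩ := hσ y' hy' hy1' hy2'
    have hσσ : σ y = σ y' := by
      by_contra hne
      have n1 : σ y ≠ i₁ := fun h => e1 (by rw [h, h1]; simp)
      have n2 : σ y' ≠ i₁ := fun h => e1' (by rw [h, h1]; simp)
      refine hp.det3_ne_zero n1.symm n2.symm hne ?_
      rw [div_eq_div_iff e1 e1'] at h
      rw [h1]
      simp only [det3]
      simp
      linear_combination -h
    rw [← hσσ, e2] at e2'
    exact mul_right_cancel₀ e1 e2'
  · intro y hy hy1 hy2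
    obtain ⟨e1, e2⟩ := hσ y hy hy1 hy2
    have e := hcubic (σ y)
    rw [ha, hb, e2] at e
    have ea : a2 = -(a1 * t₁) := by linear_combination ht₁
    have eb : b2 = -(b1 * t₂) := by linear_combination ht₂
    rw [ea, eb] at e
    field_simp
    apply mul_left_cancel₀ (pow_ne_zero 2 e1)
    linear_combination e
  obtain ⟨hβ, hγ⟩ := hroot
  rcases hγ with rfl | rfl
  · refine ⟨-β, a1 * b2, a1 * b1, neg_ne_zero.2 hβ, mul_ne_zero ha1 hb2, mul_ne_zero ha1 hb1,
      fun i => ?_⟩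
    by_cases hi : i = i₀
    · rw [hi, h0]; simp
    · apply mul_left_cancel₀ (hab i hi).1
      have e := hcubic i
      rw [hb] at e
      have eaa := ha (p i)
      linear_combination a1 * e - β * p i 1 * p i 2 * eaa - β * p i 1 * p i 2 * p i 2 * ht₁
  · refine ⟨-β, b1 * a2, b1 * a1, neg_ne_zero.2 hβ, mul_ne_zero hb1 ha2, mul_ne_zero hb1 ha1,
      fun i => ?_⟩
    by_cases hi : i = i₀
    · rw [hi, h0]; simp
    · apply mul_left_cancel₀ (hab i hi).2
      have e := hcubic i
      rw [ha] at e
      have ebb := hb (p i)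
      linear_combination b1 * e - β * p i 1 * p i 2 * ebb - β * p i 1 * p i 2 * p i 2 * ht₂

/-- In a plane over a finite field of odd order `q`, every `q`-arc lies on a conic. The conic can
be taken irreducible, so that its coefficients in a coordinate system with base points on the arc do
not vanish. -/
theorem exists_conic (hq : Odd (Nat.card F)) (hp : ArcFamily (F := F) p)
    (hι : Nat.card ι = Nat.card F) {i₀ i₁ i₂ : ι}
    (h0 : p i₀ = Pi.single 0 1) (h1 : p i₁ = Pi.single 1 1) (h2 : p i₂ = Pi.single 2 1) :
    ∃ A B C : F, A ≠ 0 ∧ B ≠ 0 ∧ C ≠ 0 ∧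
      ∀ i, A * (p i 1 * p i 2) + B * (p i 2 * p i 0) + C * (p i 0 * p i 1) = 0 := by
  classical
  have : Finite ι := Nat.finite_of_card_ne_zero (hι ▸ Nat.card_pos.ne')
  have := Fintype.ofFinite ι
  have h20 := two_ne_zero_of_odd_card hq
  have n01 : i₀ ≠ i₁ := fun h => by rw [← h, h0] at h1; simpa using congrFun h1 0
  have n02 : i₀ ≠ i₂ := fun h => by rw [← h, h0] at h2; simpa using congrFun h2 0
  have n12 : i₁ ≠ i₂ := fun h => by rw [← h, h1] at h2; simpa using congrFun h2 1
  by_cases hspan : Submodule.span F (Set.range fun i => veronese (p i)) = ⊤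
  · have hF : 5 < Nat.card F := by
      have := finrank_range_le_card (R := F) (fun i => veronese (p i))
      rw [Set.finrank, hspan, finrank_top] at this
      rw [← hι, Nat.card_eq_fintype_card]
      rwa [Module.finrank_fin_fun] at this
    obtain ⟨a, b, hab0, hab, hdet, hsurj, hanti⟩ := exists_antisymm_tangent_forms hq hp hι
    obtain ⟨β, γ, hcubic⟩ := exists_cubic h20 hab0 hanti h0 h1 h2 hspan
    obtain ⟨k, hk, hdet⟩ := hdet i₀
    exact exists_conic_of_cubic hF h20 hp h0 h1 h2 (hab0 i₀).1 (hab0 i₀).2 (hab i₀) hk hdet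
      (hsurj i₀) hcubic
  by_cases hF : Nat.card F ≤ 3
  · -- the arc consists of the base points
    have hall : ∀ i, i = i₀ ∨ i = i₁ ∨ i = i₂ := by
      intro i
      by_contra! h
      have : ({i, i₀, i₁, i₂} : Finset ι).card = 4 := by
        rw [Finset.card_insert_of_notMem (by simp [h]), Finset.card_insert_of_notMem
          (by simp [n01, n02]), Finset.card_pair n12]
      have h4 := Finset.card_le_univ ({i, i₀, i₁, i₂} : Finset ι)
      rw [this, ← Nat.card_eq_fintype_card, hι] at h4
      omega
    refine ⟨1, 1, 1, one_ne_zero, one_ne_zero, one_ne_zero, fun i => ?_⟩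
    rcases hall i with rfl | rfl | rfl
    · rw [h0]; simp
    · rw [h1]; simp
    · rw [h2]; simp
  obtain ⟨c, hc, hcle⟩ := Submodule.exists_le_ker_of_lt_top _ (lt_top_iff_ne_top.2 hspan)
  have hcv : ∀ i, c (veronese (p i)) = 0 := fun i => hcle (Submodule.subset_span ⟨i, rfl⟩)
  obtain ⟨d, hd⟩ : ∃ d : Fin 6 → F, ∀ x, c x = ∑ k, d k * x k :=
    ⟨fun k => c (Pi.single k 1), fun x => by
      rw [LinearMap.pi_apply_eq_sum_univ c x]
      refine Finset.sum_congr rfl fun k _ => ?_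
      have : (fun j => if k = j then (1 : F) else 0) = Pi.single k 1 := by
        ext j; simp [Pi.single_apply, eq_comm]
      rw [this, smul_eq_mul, mul_comm]⟩
  have hquad : ∀ i, d 0 * (p i 0 * p i 0) + d 1 * (p i 1 * p i 1) + d 2 * (p i 2 * p i 2) +
      d 3 * (p i 1 * p i 2) + d 4 * (p i 2 * p i 0) + d 5 * (p i 0 * p i 1) = 0 := by
    intro i
    have := hcv i
    rw [hd] at this
    simp [veronese, Fin.sum_univ_succ] at this
    linear_combination this
  have d0 : d 0 = 0 := by simpa [h0] using hquad i₀
  have d1 : d 1 = 0 := by simpa [h1] using hquad i₁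
  have d2 : d 2 = 0 := by simpa [h2] using hquad i₂
  simp only [d0, d1, d2, zero_mul, zero_add] at hquad
  have hdne : ¬ (d 3 = 0 ∧ d 4 = 0 ∧ d 5 = 0) := by
    rintro ⟨d3, d4, d5⟩
    refine hc (LinearMap.ext fun x => ?_)
    rw [hd, LinearMap.zero_apply]
    refine Finset.sum_eq_zero fun k _ => ?_
    fin_cases k <;> simp [d0, d1, d2, d3, d4, d5]
  -- as `q ≥ 5`, there are two more points on the arc
  obtain ⟨i₃, i₄, n34, hi₃, hi₄⟩ : ∃ i₃ i₄, i₃ ≠ i₄ ∧ i₃ ∉ ({i₀, i₁, i₂} : Finset ι) ∧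
      i₄ ∉ ({i₀, i₁, i₂} : Finset ι) := by
    have hc3 : ({i₀, i₁, i₂} : Finset ι).card ≤ 3 := Finset.card_le_three
    have hc2 : 1 < ({i₀, i₁, i₂} : Finset ι)ᶜ.card := by
      rw [Finset.card_compl, ← Nat.card_eq_fintype_card, hι]
      rw [Nat.odd_iff] at hq
      omega
    obtain ⟨i₃, h3, i₄, h4, n34⟩ := Finset.one_lt_card.1 hc2
    exact ⟨i₃, i₄, n34, Finset.mem_compl.1 h3, Finset.mem_compl.1 h4⟩
  simp only [Finset.mem_insert, Finset.mem_singleton, not_or] at hi₃ hi₄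
  have hne : ∀ i, i ≠ i₀ ∧ i ≠ i₁ ∧ i ≠ i₂ → p i 0 ≠ 0 ∧ p i 1 ≠ 0 ∧ p i 2 ≠ 0 := by
    rintro i ⟨m0, m1, m2⟩
    have e0 := hp.det3_ne_zero n12 m1.symm m2.symm
    have e1 := hp.det3_ne_zero n02 m0.symm m2.symm
    have e2 := hp.det3_ne_zero n01 m0.symm m1.symm
    rw [h1, h2] at e0
    rw [h0, h2] at e1
    rw [h0, h1] at e2
    simp [det3] at e0 e1 e2
    exact ⟨e0, e1, e2⟩
  have hx := hne i₃ hi₃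
  have hy := hne i₄ hi₄
  have e0 := hp.det3_ne_zero (Ne.symm hi₃.1) (Ne.symm hi₄.1) n34
  have e1 := hp.det3_ne_zero (Ne.symm hi₃.2.1) (Ne.symm hi₄.2.1) n34
  have e2 := hp.det3_ne_zero (Ne.symm hi₃.2.2) (Ne.symm hi₄.2.2) n34
  rw [h0] at e0
  rw [h1] at e1
  rw [h2] at e2
  simp [det3] at e0 e1 e2
  have q3 := hquad i₃
  have q4 := hquad i₄
  refine ⟨d 3, d 4, d 5, fun d3 => ?_, fun d4 => ?_, fun d5 => ?_, hquad⟩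
  · rw [d3] at q3 q4
    have f3 : d 4 * p i₃ 2 + d 5 * p i₃ 1 = 0 :=
      mul_left_cancel₀ hx.1 (by linear_combination q3)
    have f4 : d 4 * p i₄ 2 + d 5 * p i₄ 1 = 0 :=
      mul_left_cancel₀ hy.1 (by linear_combination q4)
    refine hdne ⟨d3, mul_right_cancel₀ e0 ?_, mul_right_cancel₀ e0 ?_⟩
    · linear_combination p i₃ 1 * f4 - p i₄ 1 * f3
    · linear_combination p i₄ 2 * f3 - p i₃ 2 * f4
  · rw [d4] at q3 q4
    have f3 : d 3 * p i₃ 2 + d 5 * p i₃ 0 = 0 :=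
      mul_left_cancel₀ hx.2.1 (by linear_combination q3)
    have f4 : d 3 * p i₄ 2 + d 5 * p i₄ 0 = 0 :=
      mul_left_cancel₀ hy.2.1 (by linear_combination q4)
    refine hdne ⟨mul_right_cancel₀ e1 ?_, d4, mul_right_cancel₀ e1 ?_⟩
    · linear_combination p i₄ 0 * f3 - p i₃ 0 * f4
    · linear_combination p i₃ 2 * f4 - p i₄ 2 * f3
  · rw [d5] at q3 q4
    have f3 : d 3 * p i₃ 1 + d 4 * p i₃ 0 = 0 :=
      mul_left_cancel₀ hx.2.2 (by linear_combination q3)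
    have f4 : d 3 * p i₄ 1 + d 4 * p i₄ 0 = 0 :=
      mul_left_cancel₀ hy.2.2 (by linear_combination q4)
    refine hdne ⟨mul_right_cancel₀ e2 ?_, mul_right_cancel₀ e2 ?_, d5⟩
    · linear_combination p i₃ 0 * f4 - p i₄ 0 * f3
    · linear_combination p i₄ 1 * f3 - p i₃ 1 * f4

end Segre

/-! ### Parametrisation of the arc -/

section StandardForm

variable {F : Type u} [Field F]

/-- Parametrisation of an arc of size `q` on an irreducible conic through the base points, in such
a way that the missing point of the conic gets the parameter `∞`. -/
theorem exists_parametrisation [Finite F] {ι : Type*} {p : ι → Fin 3 → F} (h20 : (2 : F) ≠ 0)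
    (hp : ArcFamily (F := F) p) (hι : Nat.card ι = Nat.card F) {i₀ i₁ : ι}
    (h0 : p i₀ = Pi.single 0 1) (h1 : p i₁ = Pi.single 1 1)
    {A B C : F} (hA : A ≠ 0) (hB : B ≠ 0) (hC : C ≠ 0)
    (hconic : ∀ i, A * (p i 1 * p i 2) + B * (p i 2 * p i 0) + C * (p i 0 * p i 1) = 0) :
    ∃ w : Fin 3 → Fin 3 → F, LinearIndependent F w ∧
      (∀ i, ∃ σ k : F, k ≠ 0 ∧ p i = k • (σ ^ 2 • w 0 + (2 * σ) • w 1 + w 2)) ∧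
      ∀ σ : F, ∃ i, ∃ k : F, k ≠ 0 ∧ p i = k • (σ ^ 2 • w 0 + (2 * σ) • w 1 + w 2) := by
  classical
  have : Finite ι := Nat.finite_of_card_ne_zero (hι ▸ Nat.card_pos.ne')
  have := Fintype.ofFinite ι
  have := Fintype.ofFinite F
  have n01 : i₀ ≠ i₁ := fun h => by rw [← h, h0] at h1; simpa using congrFun h1 0
  have hx2 : ∀ i, i ≠ i₀ → i ≠ i₁ → p i 2 ≠ 0 := by
    intro i m0 m1 h
    refine hp.det3_ne_zero n01 m0.symm m1.symm ?_
    rw [h0, h1]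
    simp [det3, h]
  -- `y i` is the slope of the line joining `p i` to `p i₀`; for `i = i₀` it is that of the tangent
  let y : ι → F := fun i => if i = i₀ then -B / C else p i 1 / p i 2
  have hy0 : y i₀ = -B / C := by simp [y]
  have hy : ∀ i, i ≠ i₀ → i ≠ i₁ → p i 1 = y i * p i 2 := by
    intro i m0 m1
    simp only [y, if_neg m0]
    exact (div_mul_cancel₀ _ (hx2 i m0 m1)).symm
  have hden : ∀ i, i ≠ i₀ → i ≠ i₁ → B + C * y i ≠ 0 := by
    intro i m0 m1 h
    have e := hconic i
    have hz := hx2 i m0 m1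
    rw [hy i m0 m1] at e
    have e1 : A * y i * (p i 2 * p i 2) = 0 := by linear_combination e - p i 2 * p i 0 * h
    have e2 : y i = 0 := by simpa [hA, hz] using e1
    rw [e2] at h
    exact hB (by linear_combination h)
  have hinj : Set.InjOn y ((Finset.univ : Finset ι).erase i₁) := by
    intro i hi j hj hij
    have hi : i ≠ i₁ := by simpa using hi
    have hj : j ≠ i₁ := by simpa using hj
    have hfix : ∀ l, l ≠ i₁ → y l = y i₀ → l = i₀ := by
      intro l hl h
      by_contra m0
      refine hden l m0 hl ?_
      rw [h, hy0]
      field_simp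
      ring
    by_cases m0 : i = i₀
    · rw [m0] at hij ⊢
      exact (hfix j hj hij.symm).symm
    by_cases m0' : j = i₀
    · rw [m0'] at hij ⊢
      exact hfix i hi hij
    by_contra hne
    refine hp.det3_ne_zero (Ne.symm m0) (Ne.symm m0') hne ?_
    rw [h0]
    simp only [det3]
    simp
    rw [hy i m0 hi, hy j m0' hj, hij]
    ring
  obtain ⟨t, ht⟩ : ∃ t : F, Finset.univ \ ((Finset.univ : Finset ι).erase i₁).image y = {t} := by
    rw [← Finset.card_eq_one, Finset.card_sdiff_of_subset (Finset.subset_univ _),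
      Finset.card_image_of_injOn hinj, Finset.card_erase_of_mem (Finset.mem_univ _),
      Finset.card_univ, Finset.card_univ, ← Nat.card_eq_fintype_card, ← Nat.card_eq_fintype_card,
      hι]
    have : 1 < Nat.card F := Finite.one_lt_card
    omega
  have hyt : ∀ c : F, (∃ i, i ≠ i₁ ∧ y i = c) ↔ c ≠ t := by
    intro c
    have : c ∈ Finset.univ \ ((Finset.univ : Finset ι).erase i₁).image y ↔ c ∈ ({t} : Finset F) :=
      by rw [ht]
    rw [ne_eq, ← Finset.mem_singleton, ← this]
    simp
  -- the point of the conic with slope `y i`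
  have hφ : ∀ i, i ≠ i₁ → ∃ k : F, k ≠ 0 ∧
      p i = k • ![-A * y i, y i * (B + C * y i), B + C * y i] := by
    intro i m1
    by_cases m0 : i = i₀
    · refine ⟨C / (A * B), div_ne_zero hC (mul_ne_zero hA hB), ?_⟩
      have hz : B + C * (-B / C) = 0 := by rw [mul_div_cancel₀ _ hC, add_neg_cancel]
      rw [m0, h0, hy0, hz]
      ext m
      fin_cases m
      · simp
        field_simp
      · simp
      · simp
    · have hd := hden i m0 m1
      have hz := hx2 i m0 m1
      refine ⟨p i 2 / (B + C * y i), div_ne_zero hz hd, ?_⟩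
      have e := hconic i
      have e1 := hy i m0 m1
      ext m
      fin_cases m
      · simp
        field_simp
        apply mul_left_cancel₀ hz
        rw [e1] at e
        linear_combination e
      · simp
        field_simp
        rw [e1, mul_comm]
      · simp
        field_simp
  -- expand the point with slope `t + 1 / σ` in powers of `σ`
  let w : Fin 3 → Fin 3 → F := ![![-A * t, t * (B + C * t), B + C * t],
    ![-A / 2, (B + 2 * C * t) / 2, C / 2], ![0, C, 0]]
  have hψ : ∀ σ : F, σ ≠ 0 → ![-A * (t + 1 / σ), (t + 1 / σ) * (B + C * (t + 1 / σ)),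
      B + C * (t + 1 / σ)] = (1 / σ ^ 2) • (σ ^ 2 • w 0 + (2 * σ) • w 1 + w 2) := by
    intro σ hσ
    ext m
    fin_cases m <;> simp [w] <;> field_simp <;> ring
  have hi₁ : p i₁ = C⁻¹ • ((0 : F) ^ 2 • w 0 + (2 * 0 : F) • w 1 + w 2) := by
    rw [h1]
    ext m
    fin_cases m <;> simp [w, hC]
  refine ⟨w, ?_, ?_, ?_⟩
  · rw [Fintype.linearIndependent_iff]
    intro g hg
    rw [Fin.sum_univ_three] at hg
    have g0 := congrFun hg 0
    have g1 := congrFun hg 1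
    have g2 := congrFun hg 2
    simp [w] at g0 g1 g2
    have e0 : g 0 * t + g 1 / 2 = 0 := mul_left_cancel₀ hA (by linear_combination -g0)
    have e1 : g 0 = 0 := mul_left_cancel₀ hB (by linear_combination g2 - C * e0)
    rw [e1] at e0 g1
    have e2 : g 1 = 0 := by
      have : 2 * (g 1 / 2) = g 1 := mul_div_cancel₀ _ h20
      rw [← this]
      linear_combination 2 * e0
    rw [e2] at g1
    have e3 : g 2 = 0 := mul_right_cancel₀ hC (by linear_combination g1)
    intro i
    fin_cases i
    exacts [e1, e2, e3]
  · intro i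
    by_cases m1 : i = i₁
    · exact ⟨0, C⁻¹, inv_ne_zero hC, by rw [m1, hi₁]⟩
    have hne : y i - t ≠ 0 := sub_ne_zero.2 ((hyt _).1 ⟨i, m1, rfl⟩)
    obtain ⟨k, hk, hpk⟩ := hφ i m1
    have hσ : 1 / (y i - t) ≠ 0 := one_div_ne_zero hne
    refine ⟨1 / (y i - t), k * (1 / (1 / (y i - t)) ^ 2),
      mul_ne_zero hk (one_div_ne_zero (pow_ne_zero 2 hσ)), ?_⟩
    rw [mul_smul, ← hψ _ hσ, one_div_one_div, add_sub_cancel]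
    exact hpk
  · intro σ
    by_cases hσ : σ = 0
    · exact ⟨i₁, C⁻¹, inv_ne_zero hC, by rw [hσ, hi₁]⟩
    obtain ⟨i, m1, hi⟩ := (hyt (t + 1 / σ)).2 (by simpa using hσ)
    obtain ⟨k, hk, hpk⟩ := hφ i m1
    refine ⟨i, k * (1 / σ ^ 2), mul_ne_zero hk (one_div_ne_zero (pow_ne_zero 2 hσ)), ?_⟩
    rw [mul_smul, ← hψ _ hσ, ← hi]
    exact hpk

theorem ArcFamily.map {W W' ι : Type*} [AddCommGroup W] [Module F W] [AddCommGroup W']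
    [Module F W'] {p : ι → W} (hp : ArcFamily (F := F) p) (e : W ≃ₗ[F] W') :
    ArcFamily (F := F) (fun i => e (p i)) where
  pair i j hij := by
    have := (hp.pair i j hij).map' e.toLinearMap e.ker
    rwa [show ⇑e.toLinearMap ∘ ![p i, p j] = ![e (p i), e (p j)] by
      ext k; fin_cases k <;> rfl] at this
  triple i j k hij hik hjk c h1 h2 h3 := by
    have := hp.triple i j k hij hik hjk (c ∘ₗ e.toLinearMap) h1 h2 h3
    ext x
    have h := LinearMap.congr_fun this (e.symm x)
    simpa using h

/-- Segre's theorem for `q`-arcs: if `q` is odd, a `q`-arc is a conic minus a point. -/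
theorem exists_standard_form [Finite F] {W ι : Type*} [AddCommGroup W] [Module F W] {p : ι → W}
    (hW : Module.finrank F W = 3) (hq : Odd (Nat.card F)) (hp : ArcFamily (F := F) p)
    (hι : Nat.card ι = Nat.card F) :
    ∃ w : Module.Basis (Fin 3) F W,
      (∀ i, ∃ σ k : F, k ≠ 0 ∧ p i = k • (σ ^ 2 • w 0 + (2 * σ) • w 1 + w 2)) ∧
      ∀ σ : F, ∃ i, ∃ k : F, k ≠ 0 ∧ p i = k • (σ ^ 2 • w 0 + (2 * σ) • w 1 + w 2) := by
  have : Finite ι := Nat.finite_of_card_ne_zero (hι ▸ Nat.card_pos.ne')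
  have := Fintype.ofFinite ι
  have hcard : 2 < Fintype.card ι := by
    have : 1 < Nat.card F := Finite.one_lt_card
    rw [← Nat.card_eq_fintype_card, hι]
    rw [Nat.odd_iff] at hq
    omega
  obtain ⟨i₀, i₁, i₂, n01, n02, n12⟩ := Fintype.two_lt_card_iff.1 hcard
  have hspan : ⊤ ≤ Submodule.span F (Set.range ![p i₀, p i₁, p i₂]) := by
    by_contra h
    obtain ⟨c, hc, hle⟩ := Submodule.exists_le_ker_of_lt_top _ (lt_top_iff_ne_top.2
      (fun h' => h h'.ge))
    have hmem : ∀ k : Fin 3, c (![p i₀, p i₁, p i₂] k) = 0 := fun k =>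
      hle (Submodule.subset_span ⟨k, rfl⟩)
    exact hc (hp.triple i₀ i₁ i₂ n01 n02 n12 c (hmem 0) (hmem 1) (hmem 2))
  let b := basisOfTopLeSpanOfCardEqFinrank _ hspan (by simp [hW])
  have hb : ⇑b = ![p i₀, p i₁, p i₂] := coe_basisOfTopLeSpanOfCardEqFinrank _ _ _
  have hbk : ∀ k : Fin 3, b.equivFun (![p i₀, p i₁, p i₂] k) = Pi.single k 1 := by
    intro k
    rw [← hb]
    ext j
    rw [Module.Basis.equivFun_apply, Module.Basis.repr_self, Finsupp.single_eq_pi_single]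
  have hp' := hp.map b.equivFun
  obtain ⟨A, B, C, hA, hB, hC, hconic⟩ := exists_conic hq hp' hι (hbk 0) (hbk 1) (hbk 2)
  obtain ⟨w, hw, hw1, hw2⟩ := exists_parametrisation (two_ne_zero_of_odd_card hq) hp' hι
    (hbk 0) (hbk 1) hA hB hC hconic
  let w' := (basisOfLinearIndependentOfCardEqFinrank hw (by simp)).map b.equivFun.symm
  have hw' : ∀ k, b.equivFun (w' k) = w k := fun k => by
    rw [Module.Basis.map_apply, LinearEquiv.apply_symm_apply,
      coe_basisOfLinearIndependentOfCardEqFinrank]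
  have key : ∀ (σ k : F) i, b.equivFun (p i) = k • (σ ^ 2 • w 0 + (2 * σ) • w 1 + w 2) →
      p i = k • (σ ^ 2 • w' 0 + (2 * σ) • w' 1 + w' 2) := by
    intro σ k i h
    apply b.equivFun.injective
    simp only [map_smul, map_add, hw']
    exact h
  refine ⟨w', fun i => ?_, fun σ => ?_⟩
  · obtain ⟨σ, k, hk, h⟩ := hw1 i
    exact ⟨σ, k, hk, key σ k i h⟩
  · obtain ⟨i, k, hk, h⟩ := hw2 σ
    exact ⟨i, k, hk, key σ k i h⟩

end StandardForm

/-! ### The isomorphism with the Ahrens-Szekeres quadrangle -/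

section Isomorphism

variable {F : Type u} [Field F] {V : Type v} [AddCommGroup V] [Module F V]

/-- Coordinates in which the arc `K` in the plane `δ = 0` consists of the points
`(s² : 2s : 1)`: a basis `w` of the plane, an affine point `u₀` as origin, the three coordinate
forms `X` on the whole space that vanish at `u₀`, and the points `P s` of the arc. -/
structure ConicFrame (δ : Module.Dual F V) (K : Set (ℙ F V)) where
  w : Fin 3 → V
  u₀ : V
  X : Fin 3 → Module.Dual F V
  P : F → K
  δ_w : ∀ k, δ (w k) = 0
  δ_u₀ : δ u₀ = 1
  X_w : ∀ j k, X j (w k) = if j = k then 1 else 0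
  X_u₀ : ∀ k, X k u₀ = 0
  eq_zero : ∀ v, δ v = 0 → X 0 v = 0 → X 1 v = 0 → X 2 v = 0 → v = 0
  P_surjective : Function.Surjective P
  submodule_P : ∀ s, (P s).1.submodule = Submodule.span F {s ^ 2 • w 0 + (2 * s) • w 1 + w 2}

theorem exists_conicFrame [Finite F] {δ : Module.Dual F V} {K : Set (ℙ F V)}
    (hH : Module.finrank F (LinearMap.ker δ) = 3) (hδ : ∃ u, δ u = 1)
    (hK : IsArc (LinearMap.ker δ) K) (hcard : K.ncard = Nat.card F) (hq : Odd (Nat.card F)) :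
    Nonempty (ConicFrame δ K) := by
  obtain ⟨u₀, hu₀⟩ := hδ
  obtain ⟨b, hb1, hb2⟩ := exists_standard_form hH hq hK.arcFamily (by rw [← hcard]; rfl)
  have hspan : ∀ (Q : K) (s k : F), k ≠ 0 →
      (⟨Q.1.rep, (submodule_le_iff _ _).1 (hK.1 _ Q.2)⟩ : LinearMap.ker δ) =
        k • (s ^ 2 • b 0 + (2 * s) • b 1 + b 2) →
      Q.1.submodule =
        Submodule.span F {s ^ 2 • (b 0 : V) + (2 * s) • (b 1 : V) + (b 2 : V)} := by
    intro Q s k hk h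
    have h' : Q.1.rep = k • (s ^ 2 • (b 0 : V) + (2 * s) • (b 1 : V) + (b 2 : V)) :=
      Subtype.ext_iff.1 h
    rw [Q.1.submodule_eq, h', Submodule.span_singleton_smul_eq (IsUnit.mk0 k hk)]
  choose P hP using fun s : F => show ∃ Q : K, Q.1.submodule =
      Submodule.span F {s ^ 2 • (b 0 : V) + (2 * s) • (b 1 : V) + (b 2 : V)} from by
    obtain ⟨Q, k, hk, h⟩ := hb2 s
    exact ⟨Q, hspan Q s k hk h⟩
  choose X hX using fun k => LinearMap.exists_extend (b.coord k)
  have hXb : ∀ j (v : LinearMap.ker δ), X j v = b.coord j v := fun j v => by rw [← hX]; rfl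
  exact ⟨{
    w := fun k => b k
    u₀ := u₀
    X := fun k => X k - X k u₀ • δ
    P := P
    δ_w := fun k => (b k).2
    δ_u₀ := hu₀
    X_w := fun j k => by
      have : δ (b k : V) = 0 := (b k).2
      rw [LinearMap.sub_apply, LinearMap.smul_apply, this, smul_zero, sub_zero, hXb]
      simp [Finsupp.single_apply, eq_comm]
    X_u₀ := fun k => by simp [hu₀]
    eq_zero := fun v hv h0 h1 h2 => by
      simp only [LinearMap.sub_apply, LinearMap.smul_apply, hv, smul_zero, sub_zero] at h0 h1 h2
      have hr := b.sum_repr ⟨v, hv⟩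
      rw [Fin.sum_univ_three] at hr
      have e0 := hXb 0 ⟨v, hv⟩
      have e1 := hXb 1 ⟨v, hv⟩
      have e2 := hXb 2 ⟨v, hv⟩
      simp only [Module.Basis.coord_apply] at e0 e1 e2
      rw [← e0, ← e1, ← e2, h0, h1, h2] at hr
      simpa using Subtype.ext_iff.1 hr.symm
    P_surjective := fun Q => by
      obtain ⟨s, k, hk, h⟩ := hb1 Q
      exact ⟨s, Subtype.ext (Projectivization.submodule_injective
        ((hP s).trans (hspan Q s k hk h).symm))⟩
    submodule_P := hP }⟩

namespace ConicFrame

variable {δ : Module.Dual F V} {K : Set (ℙ F V)} (C : ConicFrame δ K)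

theorem mem_P {s : F} {x : V} (hx : δ x = 0) :
    x ∈ (C.P s).1.submodule ↔ C.X 0 x = s ^ 2 * C.X 2 x ∧ C.X 1 x = 2 * s * C.X 2 x := by
  rw [C.submodule_P, Submodule.mem_span_singleton]
  constructor
  · rintro ⟨k, rfl⟩
    simp only [map_smul, map_add, C.X_w, smul_eq_mul]
    constructor <;> simp <;> ring
  · rintro ⟨h0, h1⟩
    refine ⟨C.X 2 x, (sub_eq_zero.1 (C.eq_zero _ ?_ ?_ ?_ ?_)).symm⟩
    · simp [hx, C.δ_w]
    · simp [C.X_w, h0]; ring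
    · simp [C.X_w, h1]; ring
    · simp [C.X_w]

theorem X_two_rep_ne_zero (hK : IsArc (LinearMap.ker δ) K) (s : F) :
    C.X 2 (C.P s).1.rep ≠ 0 := by
  intro h
  have hδ : δ (C.P s).1.rep = 0 := (submodule_le_iff _ _).1 (hK.1 _ (C.P s).2)
  obtain ⟨h0, h1⟩ := (C.mem_P hδ).1 (rep_mem _)
  rw [h, mul_zero] at h0 h1
  exact (C.P s).1.rep_nonzero (C.eq_zero _ hδ h0 h1 h)

theorem P_injective (h2 : (2 : F) ≠ 0) (hK : IsArc (LinearMap.ker δ) K) :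
    Function.Injective C.P := by
  intro s t hst
  have hδ : δ (C.P s).1.rep = 0 := (submodule_le_iff _ _).1 (hK.1 _ (C.P s).2)
  have h1 := ((C.mem_P hδ).1 (rep_mem _)).2
  have h3 := ((C.mem_P (s := t) hδ).1 (by rw [← hst]; exact rep_mem _)).2
  have h4 := mul_right_cancel₀ (C.X_two_rep_ne_zero hK s) (h1.symm.trans h3)
  exact mul_left_cancel₀ h2 h4

/-- The affine point with given coordinates. -/
def affinePt (a b c : F) : {u : V // δ u = 1} :=
  ⟨C.u₀ + a • C.w 0 + b • C.w 1 + c • C.w 2, by simp [C.δ_w, C.δ_u₀]⟩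

theorem X_affinePt (a b c : F) (k : Fin 3) :
    C.X k (C.affinePt a b c) = ![a, b, c] k := by
  fin_cases k <;> simp [affinePt, C.X_w, C.X_u₀]

/-- The form cutting out the tangent at `P s` through the point `(1 : 0 : 0)` of the conic missing
from the arc. -/
def form₁ (s : F) : Module.Dual F V := C.X 1 - (2 * s) • C.X 2

/-- The form cutting out the tangent at `P s` to the conic. -/
def form₂ (s : F) : Module.Dual F V := C.X 0 - s • C.X 1 + s ^ 2 • C.X 2

theorem form₁_apply (s : F) (x : V) : C.form₁ s x = C.X 1 x - 2 * s * C.X 2 x := by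
  simp [form₁]

theorem form₂_apply (s : F) (x : V) :
    C.form₂ s x = C.X 0 x - s * C.X 1 x + s ^ 2 * C.X 2 x := by
  simp [form₂]

theorem form₁_rep (h2 : (2 : F) ≠ 0) (hK : IsArc (LinearMap.ker δ) K) (s t : F) :
    C.form₁ s (C.P t).1.rep = 0 ↔ t = s := by
  have hδ : δ (C.P t).1.rep = 0 := (submodule_le_iff _ _).1 (hK.1 _ (C.P t).2)
  have h1 := ((C.mem_P hδ).1 (rep_mem _)).2
  rw [C.form₁_apply, h1, ← sub_mul, ← mul_sub, mul_eq_zero,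
    or_iff_left (C.X_two_rep_ne_zero hK t), mul_eq_zero, or_iff_right h2, sub_eq_zero]

theorem form₂_rep (hK : IsArc (LinearMap.ker δ) K) (s t : F) :
    C.form₂ s (C.P t).1.rep = 0 ↔ t = s := by
  have hδ : δ (C.P t).1.rep = 0 := (submodule_le_iff _ _).1 (hK.1 _ (C.P t).2)
  obtain ⟨h0, h1⟩ := (C.mem_P hδ).1 (rep_mem _)
  have : C.form₂ s (C.P t).1.rep = (t - s) ^ 2 * C.X 2 (C.P t).1.rep := by
    rw [C.form₂_apply, h0, h1]; ring
  rw [this, mul_eq_zero, or_iff_left (C.X_two_rep_ne_zero hK t), sq_eq_zero_iff, sub_eq_zero]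

theorem P_le_iff (hK : IsArc (LinearMap.ker δ) K) (s : F) (c : Module.Dual F V) :
    (C.P s).1.submodule ≤ LinearMap.ker δ ⊓ LinearMap.ker c ↔ c (C.P s).1.rep = 0 := by
  rw [le_inf_iff, and_iff_right (hK.1 _ (C.P s).2), submodule_le_iff, LinearMap.mem_ker]

variable [FiniteDimensional F V]

theorem isTangent_of_apply_rep (hH : Module.finrank F (LinearMap.ker δ) = 3)
    (h2 : (2 : F) ≠ 0) (hK : IsArc (LinearMap.ker δ) K) {s : F} (c : Module.Dual F V)
    (hc : ∀ t, c (C.P t).1.rep = 0 ↔ t = s) :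
    IsTangent (LinearMap.ker δ) K (LinearMap.ker δ ⊓ LinearMap.ker c) := by
  refine isTangent_of_form hH hK (C.P s).2 (C.P (s + 1)).2 (fun h => ?_) c ((hc s).2 rfl) ?_
  · simpa using C.P_injective h2 hK (Subtype.ext h)
  · intro R hR hRP h
    obtain ⟨t, ht⟩ := C.P_surjective ⟨R, hR⟩
    obtain rfl : (C.P t).1 = R := by rw [ht]
    exact hRP (by rw [(hc t).1 h])

theorem isTangent₁ (hH : Module.finrank F (LinearMap.ker δ) = 3) (h2 : (2 : F) ≠ 0)
    (hK : IsArc (LinearMap.ker δ) K) (s : F) :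
    IsTangent (LinearMap.ker δ) K (LinearMap.ker δ ⊓ LinearMap.ker (C.form₁ s)) :=
  C.isTangent_of_apply_rep hH h2 hK _ (C.form₁_rep h2 hK s)

theorem isTangent₂ (hH : Module.finrank F (LinearMap.ker δ) = 3) (h2 : (2 : F) ≠ 0)
    (hK : IsArc (LinearMap.ker δ) K) (s : F) :
    IsTangent (LinearMap.ker δ) K (LinearMap.ker δ ⊓ LinearMap.ker (C.form₂ s)) :=
  C.isTangent_of_apply_rep hH h2 hK _ (C.form₂_rep hK s)

theorem exists_eq_of_isTangent [Finite F] (hH : Module.finrank F (LinearMap.ker δ) = 3)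
    (h2 : (2 : F) ≠ 0) (hK : IsArc (LinearMap.ker δ) K) (hcard : K.ncard = Nat.card F)
    {T : Submodule F V} (hT : IsTangent (LinearMap.ker δ) K T) :
    ∃ s, T = LinearMap.ker δ ⊓ LinearMap.ker (C.form₁ s) ∨
      T = LinearMap.ker δ ⊓ LinearMap.ker (C.form₂ s) := by
  obtain ⟨P, hP, hPT⟩ := hT.2.2.exists
  obtain ⟨s, hs⟩ := C.P_surjective ⟨P, hP⟩
  obtain rfl : (C.P s).1 = P := by rw [hs]
  obtain ⟨T₁, T₂, -, htan⟩ := exists_two_tangents hH hK hcard hP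
  have hle : ∀ c : Module.Dual F V, c (C.P s).1.rep = 0 →
      (C.P s).1.submodule ≤ LinearMap.ker δ ⊓ LinearMap.ker c := fun c hc =>
    le_inf (hK.1 _ hP) ((submodule_le_iff _ _).2 hc)
  have h1 := (htan _).1 ⟨C.isTangent₁ hH h2 hK s, hle _ ((C.form₁_rep h2 hK s s).2 rfl)⟩
  have h3 := (htan _).1 ⟨C.isTangent₂ hH h2 hK s, hle _ ((C.form₂_rep hK s s).2 rfl)⟩
  have hne : LinearMap.ker δ ⊓ LinearMap.ker (C.form₁ s) ≠
      LinearMap.ker δ ⊓ LinearMap.ker (C.form₂ s) := by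
    intro h
    have hw : C.w 0 ∈ LinearMap.ker δ ⊓ LinearMap.ker (C.form₁ s) :=
      ⟨C.δ_w 0, by simp [C.form₁_apply, C.X_w]⟩
    rw [h] at hw
    have : C.form₂ s (C.w 0) = 0 := hw.2
    simp [C.form₂_apply, C.X_w] at this
  refine ⟨s, ?_⟩
  rcases (htan T).1 ⟨hT, hPT⟩ with rfl | rfl <;> rcases h1 with h1 | h1 <;>
    rcases h3 with h3 | h3
  · exact Or.inl h1.symm
  · exact Or.inl h1.symm
  · exact Or.inr h3.symm
  · exact absurd (h1.trans h3.symm) hne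
  · exact absurd (h1.trans h3.symm) hne
  · exact Or.inr h3.symm
  · exact Or.inl h1.symm
  · exact Or.inl h1.symm

/-- The element of the incidence structure that corresponds to the point `(x, y, s)` of the
Ahrens-Szekeres quadrangle: the line through `P s` on which `form₂ s` takes the value `x` and
`form₁ s` the value `y`. -/
def toQPoint (hK : IsArc (LinearMap.ker δ) K) (z : F × F × F) : QPoint (LinearMap.ker δ) K :=
  pt hK (C.P z.2.2) (C.affinePt (z.1 + z.2.2 * z.2.1) z.2.1 0)

theorem toQPoint_eq_pt (h2 : (2 : F) ≠ 0) (hK : IsArc (LinearMap.ker δ) K) {x y s t : F}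
    {u : {u : V // δ u = 1}} : C.toQPoint hK (x, y, s) = pt hK (C.P t) u ↔
      s = t ∧ C.form₂ s u = x ∧ C.form₁ s u = y := by
  rw [toQPoint, pt_eq_pt, (C.P_injective h2 hK).eq_iff]
  refine and_congr_right fun _ => ?_
  rw [C.mem_P (sub_mem_ker _ _), C.form₁_apply, C.form₂_apply]
  simp only [map_sub, C.X_affinePt]
  simp
  constructor
  · rintro ⟨h0, h1⟩
    have hy : C.X 1 u.1 - 2 * s * C.X 2 u.1 = y := by linear_combination -h1
    exact ⟨by linear_combination -h0 + s * h1, hy⟩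
  · rintro ⟨h0, h1⟩
    exact ⟨by linear_combination -h0 - s * h1, by linear_combination -h1⟩

theorem toQPoint_bijective (h2 : (2 : F) ≠ 0) (hK : IsArc (LinearMap.ker δ) K) :
    Function.Bijective (C.toQPoint hK) := by
  constructor
  · rintro ⟨x, y, s⟩ ⟨x', y', s'⟩ h
    have h1 := (C.toQPoint_eq_pt h2 hK).1 h
    have h3 := (C.toQPoint_eq_pt h2 hK).1 (rfl : C.toQPoint hK (x', y', s') = _)
    dsimp only at h1 h3
    obtain ⟨rfl, rfl, rfl⟩ := h1
    rw [h3.2.1, h3.2.2]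
  · intro l
    obtain ⟨Q, u, rfl⟩ := pt_surjective hK l
    obtain ⟨s, rfl⟩ := C.P_surjective Q
    exact ⟨_, (C.toQPoint_eq_pt h2 hK).2 ⟨rfl, rfl, rfl⟩⟩

theorem inc_toQPoint_aff (hK : IsArc (LinearMap.ker δ) K) {x y s : F} {u : {u : V // δ u = 1}} :
    QInc _ K (C.toQPoint hK (x, y, s)) (Sum.inl (aff u)) ↔
      C.form₂ s u = x ∧ C.form₁ s u = y := by
  rw [toQPoint, inc_aff, C.mem_P (sub_mem_ker _ _), C.form₁_apply, C.form₂_apply]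
  simp only [map_sub, C.X_affinePt]
  simp
  constructor
  · rintro ⟨h0, h1⟩
    exact ⟨by linear_combination h0 - s * h1, by linear_combination h1⟩
  · rintro ⟨h0, h1⟩
    exact ⟨by linear_combination h0 + s * h1, by linear_combination h1⟩

theorem inc_toQPoint_pl₁ (h2 : (2 : F) ≠ 0) (hK : IsArc (LinearMap.ker δ) K) {x y s t : F}
    (hT : IsTangent (LinearMap.ker δ) K (LinearMap.ker δ ⊓ LinearMap.ker (C.form₁ t)))
    {u : {u : V // δ u = 1}} :
    QInc _ K (C.toQPoint hK (x, y, s)) (Sum.inr (pl ⟨_, hT⟩ u)) ↔ s = t ∧ y = C.form₁ t u := by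
  rw [toQPoint, inc_pl, C.P_le_iff hK, C.form₁_rep h2 hK, Submodule.mem_inf,
    and_iff_right (sub_mem_ker _ _), LinearMap.mem_ker, map_sub, sub_eq_zero, C.form₁_apply]
  simp [C.X_affinePt]

theorem inc_toQPoint_pl₂ (hK : IsArc (LinearMap.ker δ) K) {x y s t : F}
    (hT : IsTangent (LinearMap.ker δ) K (LinearMap.ker δ ⊓ LinearMap.ker (C.form₂ t)))
    {u : {u : V // δ u = 1}} :
    QInc _ K (C.toQPoint hK (x, y, s)) (Sum.inr (pl ⟨_, hT⟩ u)) ↔ s = t ∧ x = C.form₂ t u := by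
  rw [toQPoint, inc_pl, C.P_le_iff hK, C.form₂_rep hK, Submodule.mem_inf,
    and_iff_right (sub_mem_ker _ _), LinearMap.mem_ker, map_sub, sub_eq_zero, C.form₂_apply]
  refine and_congr_right fun hst => ?_
  obtain rfl : s = t := hst
  simp [C.X_affinePt]

theorem points_aff (hK : IsArc (LinearMap.ker δ) K) (u : {u : V // δ u = 1}) :
    {z | QInc _ K (C.toQPoint hK z) (Sum.inl (aff u))} = Set.range fun σ : F =>
      (C.X 2 u * σ ^ 2 - C.X 1 u * σ + C.X 0 u, -2 * C.X 2 u * σ + C.X 1 u, σ) := by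
  ext ⟨x, y, s⟩
  rw [Set.mem_ofPred_eq, C.inc_toQPoint_aff hK, C.form₁_apply, C.form₂_apply]
  constructor
  · rintro ⟨rfl, rfl⟩
    exact ⟨s, by ext <;> simp <;> ring⟩
  · rintro ⟨σ, h⟩
    obtain ⟨rfl, rfl, rfl⟩ : _ ∧ _ ∧ _ := by simpa using h
    constructor <;> ring

theorem points_pl₁ (h2 : (2 : F) ≠ 0) (hK : IsArc (LinearMap.ker δ) K) {t : F}
    (hT : IsTangent (LinearMap.ker δ) K (LinearMap.ker δ ⊓ LinearMap.ker (C.form₁ t)))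
    (u : {u : V // δ u = 1}) :
    {z | QInc _ K (C.toQPoint hK z) (Sum.inr (pl ⟨_, hT⟩ u))} =
      Set.range fun σ : F => (σ, C.form₁ t u, t) := by
  ext ⟨x, y, s⟩
  rw [Set.mem_ofPred_eq, C.inc_toQPoint_pl₁ h2 hK]
  simp [and_comm, eq_comm]

theorem points_pl₂ (hK : IsArc (LinearMap.ker δ) K) {t : F}
    (hT : IsTangent (LinearMap.ker δ) K (LinearMap.ker δ ⊓ LinearMap.ker (C.form₂ t)))
    (u : {u : V // δ u = 1}) :
    {z | QInc _ K (C.toQPoint hK z) (Sum.inr (pl ⟨_, hT⟩ u))} =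
      Set.range fun σ : F => (C.form₂ t u, σ, t) := by
  ext ⟨x, y, s⟩
  rw [Set.mem_ofPred_eq, C.inc_toQPoint_pl₂ hK]
  simp [and_comm, eq_comm]

/-- A line of the incidence structure is sent to the set of coordinate triples of its points. This
is a bijection onto the lines of the Ahrens-Szekeres quadrangle, injective because a line of a
generalised quadrangle is determined by its points. -/
theorem isomorphic [Finite F] (C : ConicFrame δ K)
    (hH : Module.finrank F (LinearMap.ker δ) = 3) (h2 : (2 : F) ≠ 0)
    (hK : IsArc (LinearMap.ker δ) K) (hcard : K.ncard = Nat.card F) :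
    Isomorphic (QInc (LinearMap.ker δ) K) (ASInc F) := by
  have hGQ := isGQ hH ⟨_, C.δ_u₀⟩ hK hcard
  let e := Equiv.ofBijective _ (C.toQPoint_bijective h2 hK)
  have hmem : ∀ l : QLine (LinearMap.ker δ) K,
      {z | QInc _ K (C.toQPoint hK z) l} ∈ asCurves F := by
    rintro (A | E)
    · obtain ⟨u, rfl⟩ := aff_surjective A
      exact Or.inr (Or.inr ⟨_, _, _, C.points_aff hK u⟩)
    · obtain ⟨⟨T, hT⟩, u, rfl⟩ := pl_surjective hH E
      obtain ⟨s, rfl | rfl⟩ := C.exists_eq_of_isTangent hH h2 hK hcard hT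
      · exact Or.inl ⟨_, _, C.points_pl₁ h2 hK hT u⟩
      · exact Or.inr (Or.inl ⟨_, _, C.points_pl₂ hK hT u⟩)
  let f : QLine (LinearMap.ker δ) K → asCurves F := fun l => ⟨_, hmem l⟩
  have hf : Function.Bijective f := by
    constructor
    · intro l l' hll
      have hsets : ∀ p, QInc _ K p l ↔ QInc _ K p l' := by
        intro p
        obtain ⟨z, rfl⟩ := (C.toQPoint_bijective h2 hK).2 p
        exact Set.ext_iff.1 (Subtype.ext_iff.1 hll) z
      have hcard2 : 1 < {p | QInc _ K p l}.ncard := by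
        rw [hGQ.points_on_line]
        have := hGQ.one_le_s
        omega
      obtain ⟨p, p', hp, hp', hne⟩ := Set.one_lt_ncard_iff (Set.finite_of_ncard_pos
        (by omega)) |>.1 hcard2
      exact hGQ.line_unique p p' hne l l' hp hp' ((hsets p).1 hp) ((hsets p').1 hp')
    · rintro ⟨S, ⟨a, b, rfl⟩ | ⟨a, b, rfl⟩ | ⟨a, b, c, rfl⟩⟩
      · refine ⟨Sum.inr (pl ⟨_, C.isTangent₁ hH h2 hK b⟩ (C.affinePt 0 a 0)), Subtype.ext ?_⟩
        refine (C.points_pl₁ h2 hK _ _).trans ?_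
        simp [C.form₁_apply, C.X_affinePt]
      · refine ⟨Sum.inr (pl ⟨_, C.isTangent₂ hH h2 hK b⟩ (C.affinePt a 0 0)), Subtype.ext ?_⟩
        refine (C.points_pl₂ hK _ _).trans ?_
        simp [C.form₂_apply, C.X_affinePt]
      · refine ⟨Sum.inl (aff (C.affinePt a b c)), Subtype.ext ?_⟩
        refine (C.points_aff hK _).trans ?_
        simp [C.X_affinePt]
  refine ⟨e.symm, Equiv.ofBijective f hf, fun p l => ?_⟩
  obtain ⟨z, rfl⟩ := e.surjective p
  rw [Equiv.symm_apply_apply]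
  rfl

end ConicFrame

end Isomorphism
end ArcGQ

theorem mainTheorem4 {F : Type u} [Field F] [Finite F] {V : Type v} [AddCommGroup V] [Module F V]
    (hV : Module.finrank F V = 4) (H : Submodule F V) (hH : Module.finrank F H = 3)
    (q : ℕ) (hq : Nat.card F = q) (K : Set (ℙ F V))
    (hK : ArcGQ.IsArc H K) (hcard : K.ncard = q) :
    ArcGQ.IsGQ (ArcGQ.QInc H K) (q - 1) (q + 1) ∧
      (Odd q → ArcGQ.Isomorphic (ArcGQ.QInc H K) (ArcGQ.ASInc F)) := by
  subst hq
  have : FiniteDimensional F V := Module.finite_of_finrank_pos (by omega)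
  have hlt : H < ⊤ := lt_top_iff_ne_top.2 (by rintro rfl; rw [finrank_top] at hH; omega)
  obtain ⟨δ, hδ0, hle⟩ := Submodule.exists_le_ker_of_lt_top H hlt
  have hker := Module.Dual.finrank_ker_add_one_of_ne_zero hδ0
  obtain rfl : H = LinearMap.ker δ := Submodule.eq_of_le_of_finrank_eq hle (by omega)
  have hδ : ∃ u, δ u = 1 := LinearMap.surjective hδ0 1
  refine ⟨ArcGQ.isGQ hH hδ hK hcard, fun hodd => ?_⟩
  obtain ⟨C⟩ := ArcGQ.exists_conicFrame hH hδ hK hcard hodd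
  exact C.isomorphic hH (ArcGQ.two_ne_zero_of_odd_card hodd) hK hcard
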